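/- Let $d\in\mathbb N$ and let $\Lambda=L\mathbb Z^{2d}\subset\mathbb R^{2d}$ be a symplectic lattice, i.e. $L=cA$ with $c\in\mathbb R\setminus\{0\}$ and $A\in \mathrm{Sp}(d)$, the group of real $2d\times 2d$ matrices preserving the symplectic form $[(x_1,\omega_1),(x_2,\omega_2)]=x_2\cdot\omega_1-x_1\cdot\omega_2$. Let $\xi(\Lambda)=1/|\det L|$ be its density and $\Lambda^\circ=\xi(\Lambda)^{1/d}\Lambda$ its adjoint lattice, and assume $\xi(\Lambda)>1$. For $\lambda=(x,\omega)\in\mathbb R^{2d}$ and $h\in L^2(\mathbb R^d)$ write $z(\lambda)h(t)=(T_xM_\omega h)(t)=e^{2\pi i\omega\cdot(t-x)}h(t-x)$, and call $(h,\Gamma)=\{z(\lambda)h\}_{\lambda\in\Gamma}$ the Gabor system of $h$ on a lattice $\Gamma$. Inner products are linear in the first argument. Let $f\in L^2(\mathbb R^d)$, put $f_{\lambda}=z(\lambda)f$, and suppose that $(f,\Lambda^\circ)$ is a Riesz basis for its closed linear span, i.e. that there are constants $A',B'>0$ with $A'\|c\|_2^2\le\bigl\|\sum_{\lambda_\circ}c_{\lambda_\circ}f_{\lambda_\circ}\bigr\|^2\le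 B'\|c\|_2^2$ for all finite sequences $c$ indexed by $\Lambda^\circ$. Then the Gram matrix $R$ of $(f,\Lambda^\circ)$, $R_{\lambda_\circ\lambda_\circ'}=\langle f_{\lambda_\circ'},f_{\lambda_\circ}\rangle$, is a bounded positive invertible operator on $\ell^2(\Lambda^\circ)$; the Gabor frame operator $S h=\sum_{\lambda\in\Lambda}\langle h,f_{\lambda}\rangle f_{\lambda}$ of $(f,\Lambda)$ is a bounded positive invertible operator on $L^2(\mathbb R^d)$, where the series converges unconditionally for every $h$; and $$\phi:=\sum_{\lambda_\circ\in\Lambda^\circ}\bigl(R^{-1/2}\bigr)_{\lambda_\circ,0}\,f_{\lambda_\circ}=\xi(\Lambda)^{1/2}\,S^{-1/2}f ,$$ where the series converges unconditionally in $L^2(\mathbb R^d)$ (equivalently, $\phi=S_{f,f,\Lambda}^{-1/2}f$ for the normalized frame operator $S_{f,f,\Lambda}=\xi(\Lambda)^{-1}S$). Moreover $(\phi,\Lambda^\circ)$ is an orthonormal system. -/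

import Mathlib

open MeasureTheory

noncomputable section

namespace Gabor

/-! ### Symplectic lattices in the time-frequency plane -/

/-- The time-frequency plane `ℝ²ᵈ`. A point is `(x, ω)`, where the time `x` is stored in the
coordinates `Sum.inl` and the frequency `ω` in the coordinates `Sum.inr`. -/
abbrev Phase (d : ℕ) : Type := Fin d ⊕ Fin d → ℝ

/-- The time component `x` of `(x, ω)`. -/
def timePart {d : ℕ} (p : Phase d) : EuclideanSpace ℝ (Fin d) :=
  WithLp.toLp 2 fun i => p (Sum.inl i)

/-- The frequency component `ω` of `(x, ω)`. -/
def freqPart {d : ℕ} (p : Phase d) : EuclideanSpace ℝ (Fin d) :=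
  WithLp.toLp 2 fun i => p (Sum.inr i)

/-- The set `L(ℤ²ᵈ)`: the lattice with generator matrix `L`. -/
def lattice {d : ℕ} (L : Matrix (Fin d ⊕ Fin d) (Fin d ⊕ Fin d) ℝ) : AddSubgroup (Phase d) where
  carrier := {p | ∃ k : Fin d ⊕ Fin d → ℤ, p = L.mulVec fun i => (k i : ℝ)}
  zero_mem' := ⟨0, by
    have h : (fun i : Fin d ⊕ Fin d => (((0 : Fin d ⊕ Fin d → ℤ) i : ℤ) : ℝ)) = 0 := by
      ext i; simp
    rw [h, Matrix.mulVec_zero]⟩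
  add_mem' := by
    rintro _ _ ⟨k, rfl⟩ ⟨l, rfl⟩
    refine ⟨k + l, ?_⟩
    rw [← Matrix.mulVec_add]
    congr 1
    ext i
    simp
  neg_mem' := by
    rintro _ ⟨k, rfl⟩
    refine ⟨-k, ?_⟩
    rw [← Matrix.mulVec_neg]
    congr 1
    ext i
    simp

/-- `L` generates a symplectic lattice: `L = c A` with a nonzero real `c` and a matrix `A` in the
symplectic group. -/
def IsSymplecticGenerator {d : ℕ} (L : Matrix (Fin d ⊕ Fin d) (Fin d ⊕ Fin d) ℝ) : Prop :=
  ∃ c : ℝ, c ≠ 0 ∧ ∃ A ∈ Matrix.symplecticGroup (Fin d) ℝ, L = c • A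

/-- The density `ξ` of the lattice generated by `L`, the reciprocal of the volume of a fundamental
domain. -/
def density {d : ℕ} (L : Matrix (Fin d ⊕ Fin d) (Fin d ⊕ Fin d) ℝ) : ℝ := 1 / |L.det|

/-- The adjoint `ξ ^ (1 / d) Λ` of a symplectic lattice `Λ = L(ℤ²ᵈ)` of density `ξ`. For `L = c A`
this is `c⁻² Λ`, i.e. the lattice of all points whose symplectic form with every point of `Λ` is an
integer. -/
def adjointLattice {d : ℕ} (L : Matrix (Fin d ⊕ Fin d) (Fin d ⊕ Fin d) ℝ) :
    AddSubgroup (Phase d) :=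
  lattice ((density L ^ ((1 : ℝ) / (d : ℝ))) • L)

/-! ### Time-frequency shifts and Gabor systems -/

/-- The Hilbert space `L²(ℝᵈ)` of complex-valued functions. -/
abbrev L2 (d : ℕ) : Type := Lp ℂ 2 (volume : Measure (EuclideanSpace ℝ (Fin d)))

/-- The translation `T_x f(t) = f(t - x)`. -/
def translation {d : ℕ} (x : EuclideanSpace ℝ (Fin d)) (f : L2 d) : L2 d :=
  Lp.compMeasurePreserving (fun t => t - x) (measurePreserving_sub_right volume x) f

theorem memLp_modulation {d : ℕ} (w : EuclideanSpace ℝ (Fin d)) (f : L2 d) :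
    MemLp (fun t : EuclideanSpace ℝ (Fin d) =>
      f t * Complex.exp (2 * Real.pi * Complex.I * (inner ℝ w t : ℝ))) 2 volume := by
  refine (Lp.memLp f).of_le ?_ ?_
  · refine (Lp.aestronglyMeasurable f).mul (Continuous.aestronglyMeasurable ?_)
    fun_prop
  · refine Filter.Eventually.of_forall fun t => ?_
    have h : (2 * Real.pi * Complex.I * (inner ℝ w t : ℝ) : ℂ)
        = ((2 * Real.pi * inner ℝ w t : ℝ) : ℂ) * Complex.I := by
      push_cast; ring
    rw [norm_mul, h, Complex.norm_exp_ofReal_mul_I, mul_one]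

/-- The modulation `M_ω f(t) = f(t) exp(2πi ω·t)`. -/
def modulation {d : ℕ} (w : EuclideanSpace ℝ (Fin d)) (f : L2 d) : L2 d :=
  (memLp_modulation w f).toLp

/-- The time-frequency shift `z(x, ω) = T_x M_ω`. -/
def tfShift {d : ℕ} (p : Phase d) (f : L2 d) : L2 d :=
  translation (timePart p) (modulation (freqPart p) f)

/-- The Gabor system `(f, Λ) = {z(p) f | p ∈ Λ}`, as a family indexed by `Λ`. -/
def gaborSystem {d : ℕ} (f : L2 d) (Λ : AddSubgroup (Phase d)) : Λ → L2 d :=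
  fun p => tfShift (p : Phase d) f

/-! ### Riesz bases, Gram matrices and frame operators -/

section Hilbert

variable {ι : Type*} {H : Type*} [NormedAddCommGroup H] [InnerProductSpace ℂ H]

/-- The closed linear span of a family. -/
def closedSpan (e : ι → H) : Submodule ℂ H :=
  (Submodule.span ℂ (Set.range e)).topologicalClosure

/-- The family `e` is a Riesz basis for the closed subspace `K`: it is complete in `K`, and there
are constants `A, B > 0` with `A ‖c‖² ≤ ‖∑ cⱼ eⱼ‖² ≤ B ‖c‖²` for all finite sequences `c`. -/
def IsRieszBasis (e : ι → H) (K : Submodule ℂ H) : Prop :=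
  closedSpan e = K ∧
  ∃ A B : ℝ, 0 < A ∧ 0 < B ∧ ∀ c : ι →₀ ℂ,
    A * ∑ j ∈ c.support, ‖c j‖ ^ 2 ≤ ‖∑ j ∈ c.support, c j • e j‖ ^ 2 ∧
    ‖∑ j ∈ c.support, c j • e j‖ ^ 2 ≤ B * ∑ j ∈ c.support, ‖c j‖ ^ 2

/-- The Hilbert space `ℓ²(ι)`. -/
abbrev ell2 (ι : Type*) : Type _ := lp (fun _ : ι => ℂ) 2

open Classical in
/-- The standard unit vector of `ℓ²(ι)` at `j`. -/
def unitVec (j : ι) : ell2 ι := lp.single 2 j (1 : ℂ)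

/-- The `(i, j)` entry of the matrix of a bounded operator on `ℓ²(ι)`. -/
def entry (T : ell2 ι →L[ℂ] ell2 ι) (i j : ι) : ℂ := T (unitVec j) i

/-- The bounded operator `R` on `ℓ²(ι)` is given by the Gram matrix of the family `e`, whose
`(i, j)` entry is the inner product of `e j` and `e i`, linear in `e j`. -/
def IsGramOperator (e : ι → H) (R : ell2 ι →L[ℂ] ell2 ι) : Prop :=
  ∀ i j, entry R i j = inner ℂ (e i) (e j)

/-- The bounded operator `S` is the frame operator `h ↦ ∑ⱼ ⟨h, eⱼ⟩ eⱼ` of the family `e`, where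
the series converges unconditionally for every `h`. -/
def IsFrameOperator (e : ι → H) (S : H →L[ℂ] H) : Prop :=
  ∀ h : H, HasSum (fun j => (inner ℂ (e j) h : ℂ) • e j) (S h)

/-- The power `T ^ (-1/2)` of a positive invertible operator, through the continuous functional
calculus. -/
def invSqrt [CompleteSpace H] (T : H →L[ℂ] H) : H →L[ℂ] H := T ^ (-(1 / 2) : ℝ)

end Hilbert

end Gabor

end

namespace Gabor

/-! ### Analysis and synthesis operators on ℓ², and inverse square roots -/

section Hilbert

open ContinuousLinearMap
open scoped InnerProduct

variable {ι H : Type*} [NormedAddCommGroup H] [InnerProductSpace ℂ H]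

/-! Put W_s = z(Ls) for s in ℝ²ᵈ and U_ν = z(ν) for ν in Λ°. The two families commute up to the
characters of the torus, U_ν W_s = exp(2πi χ(ν)·s) W_s U_ν, and the orthogonality relations of the
short-time Fourier transform give ∫ ⟪W_s g, k⟫ ⟪h, W_s f⟫ ds = ξ ⟪h, k⟫ ⟪g, f⟫, with inner products
conjugate-linear in the first slot. These facts are `IsDualPair`, verified in `isDualPair_tfShift`;
the duality argument uses nothing else about Gabor systems.

Unfolding the integral over ℝ²ᵈ to the unit cube shows that the periodic function s ↦ ⟪W_s* x, S
W_s* h⟫ has Fourier coefficients ξ ⟪U_ν x, h⟫ ⟪f, U_ν f⟫. Evaluating its Fourier series at 0 is the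
fundamental identity (`hasSum_adjoint_series`).

Invertibility of S is the duality principle. Integrating |η(s)|² |⟪W_s f, h⟫|² for a trigonometric
polynomial η produces the entrywise product of the Gram matrix of (U_ν h), whose diagonal is ‖h‖²,
with the transposed Gram matrix of (U_ν f). Schur's product theorem (`tensor_form_nonneg`) turns
Riesz bounds A, B into bounds ξA, ξB, and letting |η|² concentrate at 0 gives the frame bounds
(`isBessel_shift`, `lower_frame_bound`).

For the formula, let C be the synthesis operator of (f, Λ°), so that R = C*C, and let F = CC*, which
need not be invertible. The fundamental identity yields Sf = ξFf and FS = SF. With φ = C R^(-1/2) δ₀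
one has F^(1/2) φ = f. The operator S − ξF kills f, hence φ, and factors as (S^(1/2) + √ξ F^(1/2))
(S^(1/2) − √ξ F^(1/2)) with invertible first factor. Thus S^(1/2) φ = √ξ F^(1/2) φ = √ξ f
(`polar_apply_eq`). Since F commutes with every U_ν, also U_ν φ = C R^(-1/2) δ_ν, and these vectors
are orthonormal because R^(-1/2) R R^(-1/2) = 1. -/

theorem ell2_norm_sq (c : ell2 ι) : ‖c‖ ^ 2 = ∑' j, ‖c j‖ ^ 2 := by
  have h := lp.norm_rpow_eq_tsum (p := 2) (by norm_num) c
  simpa using h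

theorem inner_unitVec (j : ι) (c : ell2 ι) : inner ℂ (unitVec j) c = c j := by
  classical
  simp only [unitVec]
  rw [lp.inner_single_left]
  simp

theorem unitVec_apply (i j : ι) [Decidable (i = j)] :
    (unitVec j : ell2 ι) i = if i = j then 1 else 0 := by
  classical
  simp only [unitVec]
  rw [lp.single_apply, Pi.single_apply]
  congr

theorem hasSum_unitVec (c : ell2 ι) : HasSum (fun j => c j • (unitVec j : ell2 ι)) c := by
  classical
  have h := lp.hasSum_single (p := 2) (by norm_num) c
  refine h.congr_fun fun j => ?_
  simp only [unitVec]
  rw [← lp.single_smul]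
  simp

theorem clm_ext_unitVec {T T' : ell2 ι →L[ℂ] H} (h : ∀ j, T (unitVec j) = T' (unitVec j)) :
    T = T' := by
  ext c
  have h1 := (hasSum_unitVec c).mapL T
  have h2 := (hasSum_unitVec c).mapL T'
  simp only [map_smul, h] at h1 h2
  exact h1.unique h2

/-- The Bessel inequality for finite subfamilies. -/
def IsBessel (e : ι → H) (B : ℝ) : Prop :=
  ∀ (h : H) (F : Finset ι), ∑ j ∈ F, ‖(inner ℂ (e j) h : ℂ)‖ ^ 2 ≤ B * ‖h‖ ^ 2

theorem IsBessel.summable {e : ι → H} {B : ℝ} (hB : IsBessel e B) (h : H) :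
    Summable fun j => ‖(inner ℂ (e j) h : ℂ)‖ ^ 2 :=
  summable_of_sum_le (fun _ => by positivity) (hB h)

theorem IsBessel.exists_analysis {e : ι → H} {B : ℝ} (hB : IsBessel e B) :
    ∃ T : H →L[ℂ] ell2 ι, ∀ h j, T h j = inner ℂ (e j) h := by
  have hmem : ∀ h : H, Memℓp (fun j => (inner ℂ (e j) h : ℂ)) 2 := fun h =>
    memℓp_gen (by simpa using hB.summable h)
  let T : H →ₗ[ℂ] ell2 ι :=
    { toFun := fun h => ⟨fun j => inner ℂ (e j) h, hmem h⟩
      map_add' := fun x y => by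
        ext j
        exact inner_add_right _ _ _
      map_smul' := fun c x => by
        ext j
        exact inner_smul_right _ _ _ }
  refine ⟨T.mkContinuous √B fun h => ?_, fun h j => rfl⟩
  have h1 : ‖T h‖ ^ 2 ≤ B * ‖h‖ ^ 2 := by
    rw [ell2_norm_sq]
    exact (hB.summable h).tsum_le_of_sum_le (hB h)
  calc ‖T h‖ = √(‖T h‖ ^ 2) := (Real.sqrt_sq (norm_nonneg _)).symm
    _ ≤ √(B * ‖h‖ ^ 2) := Real.sqrt_le_sqrt h1
    _ = √B * ‖h‖ := by rw [Real.sqrt_mul' _ (sq_nonneg _), Real.sqrt_sq (norm_nonneg _)]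

/-- The Riesz inequalities, for sums over a finite set that contains the support. -/
theorem riesz_finset {e : ι → H} {A B : ℝ}
    (h : ∀ c : ι →₀ ℂ, A * ∑ j ∈ c.support, ‖c j‖ ^ 2 ≤ ‖∑ j ∈ c.support, c j • e j‖ ^ 2 ∧
      ‖∑ j ∈ c.support, c j • e j‖ ^ 2 ≤ B * ∑ j ∈ c.support, ‖c j‖ ^ 2)
    (F : Finset ι) (a : ι → ℂ) :
    A * ∑ j ∈ F, ‖a j‖ ^ 2 ≤ ‖∑ j ∈ F, a j • e j‖ ^ 2 ∧
      ‖∑ j ∈ F, a j • e j‖ ^ 2 ≤ B * ∑ j ∈ F, ‖a j‖ ^ 2 := by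
  classical
  have h1 := h (Finsupp.onFinset F (fun j => if j ∈ F then a j else 0) (by simp; tauto))
  rw [Finset.sum_subset Finsupp.support_onFinset_subset,
    Finset.sum_subset Finsupp.support_onFinset_subset] at h1
  · simp only [Finsupp.onFinset_apply] at h1
    have e1 : ∑ j ∈ F, (if j ∈ F then a j else 0) • e j = ∑ j ∈ F, a j • e j :=
      Finset.sum_congr rfl fun j hj => by simp [hj]
    have e2 : ∑ j ∈ F, ‖if j ∈ F then a j else 0‖ ^ 2 = ∑ j ∈ F, ‖a j‖ ^ 2 :=
      Finset.sum_congr rfl fun j hj => by simp [hj]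
    rwa [e1, e2] at h1
  · intro j _ hj
    rw [Finsupp.notMem_support_iff.mp hj]; simp
  · intro j _ hj
    rw [Finsupp.notMem_support_iff.mp hj]; simp

/-- The upper Riesz inequality implies the Bessel inequality. -/
theorem isBessel_of_synthesis_le {e : ι → H} {B : ℝ} (hB : 0 < B)
    (h : ∀ (F : Finset ι) (a : ι → ℂ), ‖∑ j ∈ F, a j • e j‖ ^ 2 ≤ B * ∑ j ∈ F, ‖a j‖ ^ 2) :
    IsBessel e B := by
  intro x F
  set σ := ∑ j ∈ F, ‖(inner ℂ (e j) x : ℂ)‖ ^ 2 with hσ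
  have hσ0 : 0 ≤ σ := Finset.sum_nonneg fun _ _ => by positivity
  set y := ∑ j ∈ F, (inner ℂ (e j) x : ℂ) • e j with hy
  have h1 : ‖y‖ ^ 2 ≤ B * σ := h F _
  have h2 : inner ℂ y x = (σ : ℂ) := by
    rw [hy, sum_inner, hσ]
    push_cast
    refine Finset.sum_congr rfl fun j _ => ?_
    rw [inner_smul_left, mul_comm, Complex.mul_conj, Complex.normSq_eq_norm_sq]
    push_cast; rfl
  have h3 : σ ≤ ‖y‖ * ‖x‖ := by
    have := norm_inner_le_norm (𝕜 := ℂ) y x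
    rwa [h2, Complex.norm_real, Real.norm_of_nonneg hσ0] at this
  have h4 : σ ^ 2 ≤ (B * σ) * ‖x‖ ^ 2 := by
    calc σ ^ 2 ≤ (‖y‖ * ‖x‖) ^ 2 := by gcongr
      _ = ‖y‖ ^ 2 * ‖x‖ ^ 2 := by ring
      _ ≤ _ := by gcongr
  -- The bound σ² ≤ Bσ‖x‖² is divided by σ, so σ = 0 is separate.
  rcases hσ0.eq_or_lt with h0 | h0
  · rw [← h0]; positivity
  · have : σ * σ ≤ σ * (B * ‖x‖ ^ 2) := by nlinarith
    exact le_of_mul_le_mul_left this h0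

theorem isStrictlyPositive_of_isPositive {T : H →L[ℂ] H} (hT : T.IsPositive) (hu : IsUnit T) :
    IsStrictlyPositive T :=
  IsStrictlyPositive.iff_of_unital.mpr ⟨(nonneg_iff_isPositive T).mpr hT, hu⟩

variable [CompleteSpace H]

theorem adjoint_analysis_unitVec {e : ι → H} {T : H →L[ℂ] ell2 ι}
    (hT : ∀ h j, T h j = inner ℂ (e j) h) (j : ι) : adjoint T (unitVec j) = e j := by
  refine ext_inner_right ℂ fun h => ?_
  rw [adjoint_inner_left, inner_unitVec, hT]

theorem hasSum_adjoint_analysis {e : ι → H} {T : H →L[ℂ] ell2 ι}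
    (hT : ∀ h j, T h j = inner ℂ (e j) h) (c : ell2 ι) :
    HasSum (fun j => c j • e j) (adjoint T c) := by
  have h := (hasSum_unitVec c).mapL (adjoint T)
  simpa only [map_smul, adjoint_analysis_unitVec hT] using h

theorem isFrameOperator_of_analysis {e : ι → H} {T : H →L[ℂ] ell2 ι}
    (hT : ∀ h j, T h j = inner ℂ (e j) h) : IsFrameOperator e (adjoint T ∘L T) := fun h => by
  simpa only [hT, comp_apply] using hasSum_adjoint_analysis hT (T h)

theorem isGramOperator_of_analysis {e : ι → H} {T : H →L[ℂ] ell2 ι}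
    (hT : ∀ h j, T h j = inner ℂ (e j) h) : IsGramOperator e (T ∘L adjoint T) := fun i j => by
  simp only [entry, comp_apply, adjoint_analysis_unitVec hT, hT]

/-- The lower Riesz inequality for finite sequences extends to all of `ℓ²`. -/
theorem le_norm_adjoint_analysis {e : ι → H} {T : H →L[ℂ] ell2 ι}
    (hT : ∀ h j, T h j = inner ℂ (e j) h) {A : ℝ}
    (h : ∀ (F : Finset ι) (a : ι → ℂ), A * ∑ j ∈ F, ‖a j‖ ^ 2 ≤ ‖∑ j ∈ F, a j • e j‖ ^ 2)
    (c : ell2 ι) : A * ‖c‖ ^ 2 ≤ ‖adjoint T c‖ ^ 2 := by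
  have hs : Summable fun j => ‖c j‖ ^ 2 := by
    have := (lp.memℓp c).summable (by norm_num)
    simpa using this
  have h1 : Filter.Tendsto (fun F : Finset ι => A * ∑ j ∈ F, ‖c j‖ ^ 2) Filter.atTop
      (nhds (A * ‖c‖ ^ 2)) := by
    rw [ell2_norm_sq]
    exact hs.hasSum.const_mul A
  have h2 : Filter.Tendsto (fun F : Finset ι => ‖∑ j ∈ F, c j • e j‖ ^ 2) Filter.atTop
      (nhds (‖adjoint T c‖ ^ 2)) := ((hasSum_adjoint_analysis hT c).norm.pow 2)
  exact le_of_tendsto_of_tendsto' h1 h2 fun F => h F _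

/-- Coercivity of the form ⟪T*T x, x⟫ = ‖T x‖², as in Lax–Milgram. It serves both for R, with T the
synthesis operator, and for S, with T the analysis operator. -/
theorem isUnit_adjoint_comp_self {K : Type*} [NormedAddCommGroup K] [InnerProductSpace ℂ K]
    [CompleteSpace K] (T : H →L[ℂ] K) {A : ℝ} (hA : 0 < A)
    (h : ∀ x, A * ‖x‖ ^ 2 ≤ ‖T x‖ ^ 2) : IsUnit (adjoint T ∘L T) := by
  refine isUnit_of_forall_le_norm_inner_map _ (c := ⟨A, hA.le⟩) hA fun x => ?_
  rw [comp_apply, adjoint_inner_left, inner_self_eq_norm_sq_to_K]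
  simp only [Complex.coe_algebraMap, norm_pow, Complex.norm_real, norm_norm]
  exact (mul_comm _ _).trans_le (h x)

theorem sqrt_mul_invSqrt {T : H →L[ℂ] H} (hT : IsStrictlyPositive T) :
    CFC.sqrt T * invSqrt T = 1 ∧ invSqrt T * CFC.sqrt T = 1 ∧
      invSqrt T * T * invSqrt T = 1 := by
  have h1 : CFC.sqrt T * invSqrt T = 1 := by
    rw [CFC.sqrt_eq_rpow]; exact CFC.rpow_mul_rpow_neg _ hT
  have h2 : invSqrt T * CFC.sqrt T = 1 := by
    rw [CFC.sqrt_eq_rpow]; exact CFC.rpow_neg_mul_rpow _ hT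
  refine ⟨h1, h2, ?_⟩
  calc invSqrt T * T * invSqrt T
      = invSqrt T * (CFC.sqrt T * CFC.sqrt T) * invSqrt T := by
        rw [CFC.sqrt_mul_sqrt_self T hT.nonneg]
    _ = 1 := by rw [← mul_assoc, h2, one_mul, h1]

theorem isSelfAdjoint_invSqrt (T : H →L[ℂ] H) : adjoint (invSqrt T) = invSqrt T :=
  IsSelfAdjoint.of_nonneg (CFC.rpow_nonneg (a := T))

theorem commute_sqrt {T V : H →L[ℂ] H} (h : Commute T V) : Commute (CFC.sqrt T) V := by
  rw [CFC.sqrt_eq_rpow]; exact h.cfc_nnreal _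

/-! ### The polar part C (C*C)^(-1/2) of an operator with C*C invertible -/

section Polar

variable {K : Type*} [NormedAddCommGroup K] [InnerProductSpace ℂ K] [CompleteSpace K]

/-- The positive square root of `C C*`, written through the inverse square root of `C* C`. -/
noncomputable def polarRoot (C : K →L[ℂ] H) : H →L[ℂ] H := C ∘L invSqrt (adjoint C ∘L C) ∘L adjoint C

variable {C : K →L[ℂ] H}

theorem polarRoot_nonneg : 0 ≤ polarRoot C := by
  rw [nonneg_iff_isPositive]
  exact ((nonneg_iff_isPositive _).mp
    (CFC.rpow_nonneg (a := adjoint C ∘L C))).conj_adjoint C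

/-- A self-adjoint operator and its square have the same kernel. This replaces cancelling `polarRoot
C`, which may fail to be injective. -/
theorem eq_zero_of_polarRoot_polarRoot {x : H} (h : polarRoot C (polarRoot C x) = 0) :
    polarRoot C x = 0 := by
  have hE : adjoint (polarRoot C) = polarRoot C := IsSelfAdjoint.of_nonneg polarRoot_nonneg
  rw [← inner_self_eq_zero (𝕜 := ℂ), ← adjoint_inner_left, hE, h, inner_zero_left]

variable (hR : IsStrictlyPositive (adjoint C ∘L C))
include hR

theorem polarRoot_mul_self : polarRoot C * polarRoot C = C ∘L adjoint C := by
  have h1 : polarRoot C * polarRoot C = C ∘L (invSqrt (adjoint C ∘L C) * (adjoint C ∘L C) *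
      invSqrt (adjoint C ∘L C)) ∘L adjoint C := by
    ext x; simp [polarRoot]
  rw [h1, (sqrt_mul_invSqrt hR).2.2]
  rfl

/-- By uniqueness of positive square roots, `polarRoot C` is the functional-calculus root of C C*,
and so inherits its commutation relations. -/
theorem commute_polarRoot {V : H →L[ℂ] H} (h : Commute (C ∘L adjoint C) V) :
    Commute (polarRoot C) V := by
  have h1 : CFC.sqrt (C ∘L adjoint C) = polarRoot C :=
    CFC.sqrt_unique (polarRoot_mul_self hR) polarRoot_nonneg
  rw [← h1]
  exact commute_sqrt h

theorem polarRoot_apply_invSqrt (v : K) :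
    polarRoot C (C (invSqrt (adjoint C ∘L C) v)) = C v := by
  have h := congrArg (fun Z : K →L[ℂ] K => C (Z v)) (sqrt_mul_invSqrt hR).2.2
  simpa [polarRoot] using h

/-- The preimage is C (C*C)⁻¹ v. -/
theorem exists_polarRoot_apply_eq (v : K) :
    ∃ y, polarRoot C y = C (invSqrt (adjoint C ∘L C) v) := by
  obtain ⟨u, hu⟩ := hR.isUnit
  refine ⟨C ((↑u⁻¹ : K →L[ℂ] K) v), ?_⟩
  have h : adjoint C (C ((↑u⁻¹ : K →L[ℂ] K) v)) = v := by
    have : (adjoint C ∘L C) * (↑u⁻¹ : K →L[ℂ] K) = 1 := by rw [← hu]; simp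
    simpa using congrArg (fun Z : K →L[ℂ] K => Z v) this
  simp only [polarRoot, comp_apply, h]

/-- An operator that commutes with `C C*` maps the polar part of `C` as it maps `C`. -/
theorem apply_polar_eq {V : H →L[ℂ] H} (hV : Commute (C ∘L adjoint C) V) {v w : K}
    (h : V (C v) = C w) :
    V (C (invSqrt (adjoint C ∘L C) v)) = C (invSqrt (adjoint C ∘L C) w) := by
  have hE : ∀ x, polarRoot C (V x) = V (polarRoot C x) := fun x =>
    congrArg (fun Z : H →L[ℂ] H => Z x) (commute_polarRoot hR hV).eq
  obtain ⟨y, hy⟩ := exists_polarRoot_apply_eq hR v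
  obtain ⟨z, hz⟩ := exists_polarRoot_apply_eq hR w
  -- With E = `polarRoot C`, the vector E²(Vy − z) is V C v − C w = 0, so E already kills Vy − z.
  have h1 : polarRoot C (polarRoot C (V y - z)) = 0 := by
    rw [map_sub, map_sub, hE, hy, hz, hE, polarRoot_apply_invSqrt hR,
      polarRoot_apply_invSqrt hR, h, sub_self]
  have h2 := eq_zero_of_polarRoot_polarRoot h1
  rwa [map_sub, hE, hy, hz, sub_eq_zero] at h2

/-- If `S` is positive and invertible, commutes with `C C*` and agrees on `C v` with a multiple of
`C C*`, then `S ^ (-1/2)` maps `C v` to a multiple of the image of `v` under the polar part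
of `C`. -/
theorem polar_apply_eq {S : H →L[ℂ] H} {ξ : ℝ} (hξ : 0 < ξ) (hS : IsStrictlyPositive S)
    (hcomm : Commute (C ∘L adjoint C) S) {v : K}
    (hv : S (C v) = (ξ : ℂ) • C (adjoint C (C v))) :
    C (invSqrt (adjoint C ∘L C) v) = (√ξ : ℂ) • invSqrt S (C v) := by
  set E := polarRoot C with hEdef
  set G := CFC.sqrt S with hGdef
  have hES : Commute E S := commute_polarRoot hR hcomm
  have hGE : Commute G E := commute_sqrt hES.symm
  have hGG : G * G = S := CFC.sqrt_mul_sqrt_self S hS.nonneg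
  have hEE := polarRoot_mul_self hR
  have hξ2 : (√ξ : ℂ) * √ξ = ξ := by exact_mod_cast Real.mul_self_sqrt hξ.le
  set D : H →L[ℂ] H := S - (ξ : ℂ) • (E * E) with hD
  have hDE : ∀ x, E (D x) = D (E x) := fun x => by
    have h1 := congrArg (fun Z : H →L[ℂ] H => Z x) hES.eq
    simp only [mul_def, comp_apply] at h1
    simp [hD, h1]
  have hDv : D (C v) = 0 := by
    rw [hD, hEE]
    simp [hv]
  obtain ⟨y, hy⟩ := exists_polarRoot_apply_eq hR v
  -- The polar image of v is E y, and E(E(D y)) = D(E(E y)) = D(C v) = 0; hence E(D y) = D(E y) = 0.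
  have hD0 : D (C (invSqrt (adjoint C ∘L C) v)) = 0 := by
    rw [← hy, ← hDE]
    refine eq_zero_of_polarRoot_polarRoot (C := C) ?_
    rw [← hEdef, hDE, hDE, hEdef, hy, polarRoot_apply_invSqrt hR, hDv]
  -- G is strictly positive and E is nonnegative, so the sum is invertible although E need not be.
  have hP : IsUnit (G + (√ξ : ℂ) • E) := by
    have h1 : IsStrictlyPositive G := hS.sqrt
    have h2 : (0 : H →L[ℂ] H) ≤ √ξ • E := smul_nonneg (Real.sqrt_nonneg _) polarRoot_nonneg
    exact (h1.add_nonneg h2).isUnit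
  have hfac : (G + (√ξ : ℂ) • E) * (G - (√ξ : ℂ) • E) = D := by
    rw [mul_sub, add_mul, add_mul, hGG, mul_smul_comm, smul_mul_assoc, mul_smul_comm, hGE.eq,
      smul_mul_assoc, smul_smul, hξ2, hD]
    abel
  have h0 : (G - (√ξ : ℂ) • E) (C (invSqrt (adjoint C ∘L C) v)) = 0 := by
    obtain ⟨u, hu⟩ := hP
    have h1 : (↑u⁻¹ : H →L[ℂ] H) * D = G - (√ξ : ℂ) • E := by
      rw [← hfac, ← hu, Units.inv_mul_cancel_left]
    rw [← h1, mul_def, comp_apply, hD0, map_zero]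
  rw [sub_apply, smul_apply, hEdef, polarRoot_apply_invSqrt hR, sub_eq_zero] at h0
  have h3 := congrArg (fun Z : H →L[ℂ] H => Z (C (invSqrt (adjoint C ∘L C) v)))
    (sqrt_mul_invSqrt hS).2.1
  simp only [mul_def, comp_apply] at h3
  change _ = C (invSqrt (adjoint C ∘L C) v) at h3
  rw [← h3, h0, map_smul]

end Polar

end Hilbert

/-! ### Periodization and Fourier series on the torus -/

section Torus

variable {I : Type*}

/-- The quotient map from `ℝ^I` onto the torus. -/
def torusMk (s : I → ℝ) : UnitAddTorus I := fun i => (s i : UnitAddCircle)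

/-- The half-open unit cube centred at the origin. -/
def cube (I : Type*) : Set (I → ℝ) := {s | ∀ i, s i ∈ Set.Ioc (-1 / 2 : ℝ) (-1 / 2 + 1)}

theorem continuous_torusMk : Continuous (torusMk : (I → ℝ) → UnitAddTorus I) :=
  continuous_pi fun i => (AddCircle.continuous_mk' 1).comp (continuous_apply i)

theorem torusMk_add_int (s : I → ℝ) (k : I → ℤ) :
    torusMk (s + fun i => (k i : ℝ)) = torusMk s := by
  ext i
  simp only [torusMk, Pi.add_apply, AddCircle.coe_add]
  have : ((k i : ℝ) : UnitAddCircle) = 0 :=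
    AddCircle.coe_eq_zero_iff 1 |>.mpr ⟨k i, by simp⟩
  rw [this, add_zero]

variable [Fintype I]

theorem measurableSet_cube : MeasurableSet (cube I) :=
  MeasurableSet.univ_pi' fun _ => measurableSet_Ioc

theorem volume_cube : volume (cube I) = 1 := by
  have : cube I = Set.univ.pi fun _ => Set.Ioc (-1 / 2 : ℝ) (-1 / 2 + 1) := by
    ext s; simp [cube]
  rw [this, volume_pi_pi]
  simp

instance : IsFiniteMeasure (volume.restrict (cube I)) :=
  ⟨by rw [Measure.restrict_apply_univ, volume_cube]; exact ENNReal.one_lt_top⟩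

theorem integrableOn_cube {E : Type*} [NormedAddCommGroup E] {F : (I → ℝ) → E} (hF : Continuous F) :
    IntegrableOn F (cube I) := by
  have hsub : cube I ⊆ Set.Icc (fun _ => (-1 / 2 : ℝ)) (fun _ => 1 / 2) := fun s hs =>
    ⟨fun i => (hs i).1.le, fun i => (hs i).2.trans (by norm_num)⟩
  exact (hF.integrableOn_Icc).mono_set hsub

theorem setIntegral_cube_mFourier_mul_conj (m n : I → ℤ) :
    ∫ s in cube I, UnitAddTorus.mFourier m (torusMk s) *
      (starRingEnd ℂ) (UnitAddTorus.mFourier n (torusMk s)) = if m = n then 1 else 0 := by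
  classical
  have h := orthonormal_iff_ite.mp (UnitAddTorus.orthonormal_mFourier (d := I)) n m
  rw [ContinuousMap.inner_toLp, UnitAddTorus.integral_preimage _ (fun _ => (-1 / 2 : ℝ))] at h
  simp only [eq_comm (a := n)] at h
  exact h

/-- Unfolding an integral over `ℝ^I` to the unit cube. -/
theorem hasSum_setIntegral_cube {E : Type*} [NormedAddCommGroup E] [NormedSpace ℝ E]
    {F : (I → ℝ) → E} (hF : Integrable F) :
    HasSum (fun k : I → ℤ => ∫ s in cube I, F (s + fun i => (k i : ℝ))) (∫ s, F s) := by
  have hmeas : ∀ k : I → ℤ, MeasurableSet ((fun s => s - fun i => (k i : ℝ)) ⁻¹' cube I) :=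
    fun k => measurableSet_cube.preimage (measurable_id.sub_const _)
  -- For cells (−1/2, 1/2], the unique cell containing s is read off by a ceiling.
  have hmem : ∀ (k : I → ℤ) (s : I → ℝ), s ∈ (fun s => s - fun i => (k i : ℝ)) ⁻¹' cube I ↔
      ∀ i, k i = ⌈s i - 1 / 2⌉ := by
    intro k s
    simp only [Set.mem_preimage, cube, Set.mem_ofPred_eq, Pi.sub_apply, Set.mem_Ioc]
    refine forall_congr' fun i => ?_
    rw [eq_comm, Int.ceil_eq_iff]
    constructor <;> rintro ⟨h1, h2⟩ <;> constructor <;> linarith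
  have hdisj : Pairwise (Function.onFun Disjoint
      fun k : I → ℤ => (fun s => s - fun i => (k i : ℝ)) ⁻¹' cube I) := by
    intro k l hkl
    refine Set.disjoint_left.mpr fun s hk hl => hkl ?_
    ext i
    rw [(hmem k s).mp hk i, (hmem l s).mp hl i]
  have huniv : (⋃ k : I → ℤ, (fun s => s - fun i => (k i : ℝ)) ⁻¹' cube I) = Set.univ :=
    Set.eq_univ_of_forall fun s =>
      Set.mem_iUnion.mpr ⟨fun i => ⌈s i - 1 / 2⌉, (hmem _ s).mpr fun _ => rfl⟩
  have h := hasSum_integral_iUnion hmeas hdisj (hF.integrableOn (s := ⋃ k : I → ℤ, _))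
  rw [huniv, Measure.restrict_univ] at h
  refine h.congr_fun fun k => ?_
  have hmp := measurePreserving_sub_right (volume : Measure (I → ℝ)) (fun i => (k i : ℝ))
  have he := hmp.setIntegral_preimage_emb (MeasurableEquiv.subRight _).measurableEmbedding
    (fun s => F (s + fun i => (k i : ℝ))) (cube I)
  simp only [sub_add_cancel] at he
  exact he.symm

/-- Unfolding, with the sum inside the integral. -/
theorem integral_eq_setIntegral_tsum {F : (I → ℝ) → ℂ} (hF : Integrable F) :
    ∫ s, F s = ∫ s in cube I, ∑' k : I → ℤ, F (s + fun i => (k i : ℝ)) := by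
  have h := hasSum_integral_of_summable_integral_norm (μ := volume.restrict (cube I))
    (F := fun (k : I → ℤ) s => F (s + fun i => (k i : ℝ)))
    (fun k => (hF.comp_add_right _).integrableOn) (hasSum_setIntegral_cube hF.norm).summable
  exact (hasSum_setIntegral_cube hF).unique h

/-- A continuous function with nonnegative averages against all `|η|²` on the unit cube is
nonnegative at the centre. -/
theorem nonneg_of_setIntegral_cube {u : (I → ℝ) → ℝ} (hu : Continuous u)
    (h : ∀ η : C(UnitAddTorus I, ℂ), 0 ≤ ∫ s in cube I, ‖η (torusMk s)‖ ^ 2 * u s) : 0 ≤ u 0 := by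
  by_contra! hneg
  obtain ⟨r, hr, hball⟩ := Metric.eventually_nhds_iff_ball.mp (hu.continuousAt.eventually_lt_const hneg)
  -- Radius at most 1/2 keeps the ball inside the cube; u is negative on it by the choice of r.
  set ρ := min r (1 / 2) with hρ
  have hρ0 : 0 < ρ := lt_min hr (by norm_num)
  -- A tent at the origin. On the cube the torus norm is the sup norm of the representative, so η is
  -- supported where u < 0.
  let η : C(UnitAddTorus I, ℂ) := ⟨fun x => ((max 0 (ρ - ‖x‖) : ℝ) : ℂ), by fun_prop⟩
  have hη : ∀ s ∈ cube I, η (torusMk s) = ((max 0 (ρ - ‖s‖) : ℝ) : ℂ) := by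
    intro s hs
    have : ‖torusMk s‖ = ‖s‖ := by
      simp only [torusMk, Pi.norm_def]
      congr 1
      refine Finset.sup_congr rfl fun i _ => ?_
      apply NNReal.coe_injective
      simp only [coe_nnnorm, Real.norm_eq_abs]
      rw [AddCircle.norm_coe_eq_abs_iff _ one_ne_zero, abs_one, abs_le]
      have := hs i
      constructor <;> linarith [this.1, this.2]
    simp only [η, ContinuousMap.coe_mk, this]
  have hint : ∫ s in cube I, ‖η (torusMk s)‖ ^ 2 * u s
      = ∫ s in cube I, (max 0 (ρ - ‖s‖)) ^ 2 * u s :=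
    setIntegral_congr_fun measurableSet_cube fun s hs => by simp [hη s hs]
  set g : (I → ℝ) → ℝ := fun s => -((max 0 (ρ - ‖s‖)) ^ 2 * u s) with hg
  have hgc : Continuous g := by fun_prop
  have hsupp : ∀ s, g s ≠ 0 → s ∈ Metric.ball (0 : I → ℝ) ρ := by
    intro s hs
    rw [mem_ball_zero_iff]
    by_contra! hle
    apply hs
    simp [hg, max_eq_left (sub_nonpos.mpr hle)]
  have hg0 : ∀ s, 0 ≤ g s := by
    intro s
    by_cases hs : g s = 0
    · exact hs.ge
    · have := hball s (Metric.ball_subset_ball (min_le_left _ _) (hsupp s hs))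
      simp only [hg]
      nlinarith [sq_nonneg (max 0 (ρ - ‖s‖))]
  have hsub : Metric.ball (0 : I → ℝ) ρ ⊆ cube I := by
    intro s hs i
    have h1 : |s i| < 1 / 2 := (norm_le_pi_norm s i).trans_lt
      ((mem_ball_zero_iff.mp hs).trans_le (min_le_right _ _))
    rw [abs_lt] at h1
    constructor <;> linarith [h1.1, h1.2]
  have heq : ∫ s in cube I, g s = ∫ s, g s :=
    setIntegral_eq_integral_of_forall_compl_eq_zero fun s hs => by
      by_contra hne
      exact hs (hsub (hsupp s hne))
  have hcs : HasCompactSupport g :=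
    HasCompactSupport.of_support_subset_isCompact (isCompact_closedBall (0 : I → ℝ) ρ)
      fun s hs => Metric.ball_subset_closedBall (hsupp s hs)
  have hpos : 0 < ∫ s, g s := by
    refine hgc.integral_pos_of_hasCompactSupport_nonneg_nonzero hcs hg0 (x := 0) ?_
    simp only [hg, norm_zero, sub_zero, max_eq_right hρ0.le]
    exact neg_ne_zero.mpr (mul_ne_zero (by positivity) hneg.ne)
  have h1 := h η
  rw [hint] at h1
  rw [← heq] at hpos
  simp only [hg, integral_neg] at hpos
  linarith

/-- An inequality between the quadratic forms `∫ |η|²` of two finite measures extends from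
trigonometric polynomials to all continuous functions on the torus. -/
theorem nonneg_integral_norm_sq_of_span {μ ν : Measure (I → ℝ)} [IsFiniteMeasure μ]
    [IsFiniteMeasure ν] {a b : ℝ}
    (h : ∀ η ∈ Submodule.span ℂ (Set.range (UnitAddTorus.mFourier (d := I))),
      0 ≤ a * ∫ s, ‖η (torusMk s)‖ ^ 2 ∂μ + b * ∫ s, ‖η (torusMk s)‖ ^ 2 ∂ν)
    (η : C(UnitAddTorus I, ℂ)) :
    0 ≤ a * ∫ s, ‖η (torusMk s)‖ ^ 2 ∂μ + b * ∫ s, ‖η (torusMk s)‖ ^ 2 ∂ν := by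
  have hcont : ∀ (κ : Measure (I → ℝ)) [IsFiniteMeasure κ],
      Continuous fun η : C(UnitAddTorus I, ℂ) => ∫ s, ‖η (torusMk s)‖ ^ 2 ∂κ := by
    intro κ _
    rw [continuous_iff_continuousAt]
    intro η₀
    refine continuousAt_of_dominated (bound := fun _ => (‖η₀‖ + 1) ^ 2) ?_ ?_
      (integrable_const _) ?_
    · exact Filter.Eventually.of_forall fun η =>
        (((η.continuous.comp continuous_torusMk).norm.pow 2)).aestronglyMeasurable
    · filter_upwards [Metric.ball_mem_nhds η₀ one_pos] with η hη
      refine Filter.Eventually.of_forall fun s => ?_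
      have h1 : ‖η‖ ≤ ‖η₀‖ + 1 := by
        have := norm_le_norm_add_norm_sub' η η₀
        have h2 : ‖η - η₀‖ < 1 := by simpa [dist_eq_norm] using hη
        linarith
      rw [Real.norm_of_nonneg (by positivity)]
      gcongr
      exact (η.norm_coe_le_norm _).trans h1
    · refine Filter.Eventually.of_forall fun s => ?_
      exact ((continuous_eval_const (torusMk s)).norm.pow 2).continuousAt
  have hclosed := isClosed_le (continuous_const (y := (0 : ℝ)))
    ((continuous_const (y := a)).mul (hcont μ) |>.add ((continuous_const (y := b)).mul (hcont ν)))
  have hdense : Dense (Submodule.span ℂ (Set.range (UnitAddTorus.mFourier (d := I))) :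
      Set C(UnitAddTorus I, ℂ)) :=
    Submodule.dense_iff_topologicalClosure_eq_top.mpr UnitAddTorus.span_mFourier_closure_eq_top
  exact hclosed.closure_subset_iff.mpr h (hdense η)

/-- A continuous periodic function with summable Fourier coefficients is, at the origin, the sum
of its Fourier series. -/
theorem hasSum_fourier_of_periodic {Q : (I → ℝ) → ℂ} (hQ : Continuous Q)
    (hper : ∀ s (k : I → ℤ), Q (s + fun i => (k i : ℝ)) = Q s)
    (hsum : Summable fun n : I → ℤ =>
      ∫ s in cube I, (starRingEnd ℂ) (UnitAddTorus.mFourier n (torusMk s)) * Q s) :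
    HasSum (fun n : I → ℤ =>
      ∫ s in cube I, (starRingEnd ℂ) (UnitAddTorus.mFourier n (torusMk s)) * Q s) (Q 0) := by
  have hquot : IsOpenQuotientMap (torusMk : (I → ℝ) → UnitAddTorus I) :=
    IsOpenQuotientMap.piMap fun _ => QuotientAddGroup.isOpenQuotientMap_mk
  -- Periodicity lets Q descend to a continuous function q on the torus.
  have hfac : ∀ s t : I → ℝ, torusMk s = torusMk t → Q s = Q t := by
    intro s t hst
    have h1 : ∀ i, ∃ k : ℤ, s i = t i + k := by
      intro i
      have h2 : ((s i : ℝ) : UnitAddCircle) = (t i : ℝ) := congrFun hst i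
      have h3 : ((s i - t i : ℝ) : UnitAddCircle) = 0 := by rw [AddCircle.coe_sub, h2, sub_self]
      obtain ⟨k, hk⟩ := (AddCircle.coe_eq_zero_iff 1).mp h3
      refine ⟨k, ?_⟩
      have : (k : ℝ) = s i - t i := by simpa using hk
      linarith
    choose k hk using h1
    rw [← hper t k]
    congr 1
    ext i
    exact hk i
  let q : C(UnitAddTorus I, ℂ) := 
    Topology.IsQuotientMap.lift (f := ⟨torusMk, continuous_torusMk⟩) hquot.isQuotientMap ⟨Q, hQ⟩
      fun s t => hfac s t
  have hq : ∀ s, q (torusMk s) = Q s := fun s =>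
    congrArg (fun F : C(I → ℝ, ℂ) => F s) (Topology.IsQuotientMap.lift_comp
      (f := ⟨torusMk, continuous_torusMk⟩) hquot.isQuotientMap ⟨Q, hQ⟩ fun s t => hfac s t)
  have hcoef : ∀ n : I → ℤ, UnitAddTorus.mFourierCoeff q n
      = ∫ s in cube I, (starRingEnd ℂ) (UnitAddTorus.mFourier n (torusMk s)) * Q s := by
    intro n
    rw [UnitAddTorus.mFourierCoeff_eq_integral _ _ (fun _ => (-1 / 2 : ℝ))]
    refine setIntegral_congr_fun measurableSet_cube fun s _ => ?_
    simp only [smul_eq_mul, ← UnitAddTorus.mFourier_neg, ← hq]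
    rfl
  simp only [← hcoef] at hsum ⊢
  have h := UnitAddTorus.hasSum_mFourier_series_apply_of_summable hsum (torusMk 0)
  rw [hq] at h
  refine h.congr_fun fun n => ?_
  have : UnitAddTorus.mFourier n (torusMk (0 : I → ℝ)) = 1 := by
    simp [UnitAddTorus.mFourier, torusMk]
  rw [this, smul_eq_mul, mul_one]

end Torus

/-! ### Schur products and the abstract dual pair -/

section Duality

open ContinuousLinearMap UnitAddTorus ComplexConjugate ComplexOrder

variable {H : Type*} [NormedAddCommGroup H] [InnerProductSpace ℂ H]

theorem sum_sum_inner_eq_norm_sq {N : Type*} (e : N → H) (F : Finset N) (c : N → ℂ) :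
    ∑ i ∈ F, ∑ j ∈ F, star (c i) * inner ℂ (e i) (e j) * c j
      = ((‖∑ j ∈ F, c j • e j‖ ^ 2 : ℝ) : ℂ) := by
  have h := inner_self_eq_norm_sq_to_K (𝕜 := ℂ) (∑ j ∈ F, c j • e j)
  rw [sum_inner] at h
  simp only [inner_sum, inner_smul_left, inner_smul_right] at h
  push_cast
  rw [← Complex.coe_algebraMap, ← h]
  refine Finset.sum_congr rfl fun i _ => Finset.sum_congr rfl fun j _ => ?_
  rw [← starRingEnd_apply]; ring

/-- Riesz-type inequalities survive tensoring with vectors of constant norm. -/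
theorem tensor_form_nonneg {N : Type*} {e h : N → H} {a b β : ℝ} (hn : ∀ ν, ‖h ν‖ = β)
    (hpos : ∀ (F : Finset N) (c : N → ℂ),
      0 ≤ a * ‖∑ j ∈ F, c j • e j‖ ^ 2 + b * ∑ j ∈ F, ‖c j‖ ^ 2) (c : N →₀ ℂ) {X : ℝ}
    (hX : ∑ i ∈ c.support, ∑ j ∈ c.support,
      star (c i) * (inner ℂ (h i) (h j) * inner ℂ (e j) (e i)) * c j = (X : ℂ)) :
    0 ≤ a * X + b * (β ^ 2 * ∑ j ∈ c.support, ‖c j‖ ^ 2) := by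
  classical
  have hdiag : ∀ (t : ℂ) (c : N →₀ ℂ) (v : N → ℂ), ∑ i ∈ c.support, ∑ j ∈ c.support,
      star (c i) * (v i * (t * (1 : Matrix N N ℂ) j i)) * c j
        = t * ∑ j ∈ c.support, v j * (‖c j‖ ^ 2 : ℝ) := by
    intro t c v
    rw [Finset.mul_sum]
    refine Finset.sum_congr rfl fun i hi => ?_
    rw [Finset.sum_eq_single i]
    · rw [Matrix.one_apply_eq, ← Complex.normSq_eq_norm_sq, Complex.normSq_eq_conj_mul_self,
        starRingEnd_apply]
      ring
    · intro j _ hj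
      rw [Matrix.one_apply_ne hj]; ring
    · exact fun hi' => absurd hi hi'
  -- `hpos` says exactly that a · Gram(e) + b · 1 is positive semidefinite.
  have hM : (Matrix.of fun i j => (a : ℂ) * inner ℂ (e i) (e j) + (b : ℂ) * (1 : Matrix N N ℂ) i j).PosSemidef := by
    refine ⟨?_, fun c => ?_⟩
    · ext i j
      simp only [Matrix.conjTranspose_apply, Matrix.of_apply, ← starRingEnd_apply]
      rw [Matrix.one_apply, Matrix.one_apply]
      simp only [eq_comm]
      split_ifs <;> simp
    · have h1 : (c.sum fun i xi => c.sum fun j xj => star xi * (Matrix.of fun i j =>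
          (a : ℂ) * inner ℂ (e i) (e j) + (b : ℂ) * (1 : Matrix N N ℂ) i j) i j * xj)
          = ((a * ‖∑ j ∈ c.support, c j • e j‖ ^ 2 + b * ∑ j ∈ c.support, ‖c j‖ ^ 2 : ℝ) : ℂ) := by
        have h2 := hdiag b c 1
        simp only [Pi.one_apply, one_mul] at h2
        rw [Complex.ofReal_add, Complex.ofReal_mul, Complex.ofReal_mul,
          ← sum_sum_inner_eq_norm_sq, Complex.ofReal_sum, ← h2, Finset.mul_sum,
          ← Finset.sum_add_distrib]
        refine Finset.sum_congr rfl fun i _ => ?_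
        dsimp only
        rw [Finsupp.sum, Finset.mul_sum, ← Finset.sum_add_distrib]
        refine Finset.sum_congr rfl fun j _ => ?_
        have : (1 : Matrix N N ℂ) j i = (1 : Matrix N N ℂ) i j := by
          rw [Matrix.one_apply, Matrix.one_apply]; simp only [eq_comm]
        rw [Matrix.of_apply, this]; ring
      rw [h1]
      exact_mod_cast hpos _ _
  have hG : (Matrix.of fun i j => (inner ℂ (h i) (h j) : ℂ)).PosSemidef := by
    refine ⟨?_, fun c => ?_⟩
    · ext i j
      simp only [Matrix.conjTranspose_apply, Matrix.of_apply, ← starRingEnd_apply, inner_conj_symm]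
    · have h1 := sum_sum_inner_eq_norm_sq h c.support c
      simp only [Finsupp.sum, Matrix.of_apply]
      rw [h1]
      exact Complex.zero_le_real.mpr (sq_nonneg _)
  -- Schur's product theorem. The transpose matches the order ⟪e j, e i⟫ in `hX`, and the constant
  -- diagonal of Gram(h) turns b · 1 into b β² · 1.
  have h1 := (hG.hadamard hM.transpose).2 c
  have h2 := hdiag b c fun i => inner ℂ (h i) (h i)
  have h3 : ∀ i, (inner ℂ (h i) (h i) : ℂ) = ((β ^ 2 : ℝ) : ℂ) := fun i => by
    rw [inner_self_eq_norm_sq_to_K, hn]; simp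
  have h4 : (c.sum fun i xi => c.sum fun j xj => star xi *
      ((Matrix.of fun i j => (inner ℂ (h i) (h j) : ℂ)).hadamard (Matrix.of fun i j =>
        (a : ℂ) * inner ℂ (e i) (e j) + (b : ℂ) * (1 : Matrix N N ℂ) i j).transpose) i j * xj)
      = ((a * X + b * (β ^ 2 * ∑ j ∈ c.support, ‖c j‖ ^ 2) : ℝ) : ℂ) := by
    simp only [h3, ← Finset.mul_sum, ← Complex.ofReal_sum] at h2
    rw [Complex.ofReal_add, Complex.ofReal_mul, Complex.ofReal_mul b, Complex.ofReal_mul (β ^ 2),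
      ← h2, ← hX, Finset.mul_sum, ← Finset.sum_add_distrib]
    refine Finset.sum_congr rfl fun i _ => ?_
    dsimp only
    rw [Finsupp.sum, Finset.mul_sum, ← Finset.sum_add_distrib]
    refine Finset.sum_congr rfl fun j _ => ?_
    rw [Matrix.hadamard_apply, Matrix.transpose_apply, Matrix.of_apply, Matrix.of_apply]
    by_cases hij : j = i
    · subst hij; rw [h3]; ring
    · rw [Matrix.one_apply_ne hij]; ring
  rw [h4] at h1
  exact_mod_cast h1

variable {I N : Type*} [Fintype I]

theorem norm_mFourier_apply (n : I → ℤ) (x : UnitAddTorus I) : ‖mFourier n x‖ = 1 := by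
  rw [mFourier, ContinuousMap.coe_mk, norm_prod]
  exact Finset.prod_eq_one fun i _ => by rw [fourier_apply, Circle.norm_coe]

theorem mFourier_mul_conj (n : I → ℤ) (x : UnitAddTorus I) :
    mFourier n x * conj (mFourier n x) = 1 := by
  rw [Complex.mul_conj, Complex.normSq_eq_norm_sq, norm_mFourier_apply]; simp

theorem setIntegral_cube_polynomial (χ : N ≃ (I → ℤ)) (c : N →₀ ℂ) :
    ∫ s in cube I, ‖∑ ν ∈ c.support, c ν * mFourier (χ ν) (torusMk s)‖ ^ 2
      = ∑ ν ∈ c.support, ‖c ν‖ ^ 2 := by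
  have hint : ∀ i j, IntegrableOn (fun s => (c j * conj (c i)) *
      (mFourier (χ j) (torusMk s) * conj (mFourier (χ i) (torusMk s)))) (cube I) := fun i j =>
    integrableOn_cube (continuous_const.mul
      (((mFourier _).continuous.comp continuous_torusMk).mul
        (Complex.continuous_conj.comp ((mFourier _).continuous.comp continuous_torusMk))))
  apply Complex.ofReal_injective
  rw [← integral_complex_ofReal]
  have h1 : ∀ s, ((‖∑ ν ∈ c.support, c ν * mFourier (χ ν) (torusMk s)‖ ^ 2 : ℝ) : ℂ)
      = ∑ i ∈ c.support, ∑ j ∈ c.support, (c j * conj (c i)) *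
        (mFourier (χ j) (torusMk s) * conj (mFourier (χ i) (torusMk s))) := by
    intro s
    rw [← Complex.normSq_eq_norm_sq, Complex.normSq_eq_conj_mul_self, map_sum, Finset.sum_mul_sum]
    refine Finset.sum_congr rfl fun i _ => Finset.sum_congr rfl fun j _ => ?_
    rw [map_mul]; ring
  simp only [h1]
  rw [integral_finsetSum _ fun i _ => integrable_finsetSum _ fun j _ => hint i j]
  push_cast
  refine Finset.sum_congr rfl fun i hi => ?_
  rw [integral_finsetSum _ fun j _ => hint i j, Finset.sum_eq_single i]
  · rw [integral_const_mul, setIntegral_cube_mFourier_mul_conj, if_pos rfl, mul_one,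
      Complex.mul_conj, Complex.normSq_eq_norm_sq]
    push_cast; rfl
  · intro j _ hj
    rw [integral_const_mul, setIntegral_cube_mFourier_mul_conj,
      if_neg fun h => hj (χ.injective h), mul_zero]
  · exact fun hi' => absurd hi hi'

theorem exists_finsupp_of_mem_span (χ : N ≃ (I → ℤ)) {η : C(UnitAddTorus I, ℂ)}
    (hη : η ∈ Submodule.span ℂ (Set.range (mFourier (d := I)))) :
    ∃ c : N →₀ ℂ, ∀ x, η x = ∑ ν ∈ c.support, c ν * mFourier (χ ν) x := by
  rw [← χ.surjective.range_comp, Finsupp.mem_span_range_iff_exists_finsupp] at hη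
  obtain ⟨c, rfl⟩ := hη
  exact ⟨c, fun x => by simp [Finsupp.sum]⟩

variable [AddCommGroup N]

/-- Time-frequency shifts `W` along a lattice with parameter space `ℝ^I`, together with shifts `U`
along its adjoint lattice: both families commute up to the characters of the torus, and `W`
satisfies the orthogonality relations with constant `ξ`. -/
structure IsDualPair (ξ : ℝ) (W : (I → ℝ) → H ≃ₗᵢ[ℂ] H) (U : N → H ≃ₗᵢ[ℂ] H)
    (χ : N ≃ (I → ℤ)) : Prop where
  pos : 0 < ξ
  continuous_shift : ∀ h, Continuous fun s => W s h
  shift_zero : ∀ h, W 0 h = h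
  shift_add : ∀ s t, ∃ c : ℂ, ‖c‖ = 1 ∧ ∀ h, W (s + t) h = c • W s (W t h)
  adjoint_zero : ∀ h, U 0 h = h
  adjoint_add : ∀ ν μ, ∃ c : ℂ, ‖c‖ = 1 ∧ ∀ h, U (ν + μ) h = c • U ν (U μ h)
  commute : ∀ ν s h, U ν (W s h) = mFourier (χ ν) (torusMk s) • W s (U ν h)
  integrable : ∀ g k h f, Integrable fun s => (inner ℂ (W s g) k * inner ℂ h (W s f) : ℂ)
  orthogonality : ∀ g k h f,
    ∫ s, (inner ℂ (W s g) k * inner ℂ h (W s f) : ℂ) = ξ * (inner ℂ h k * inner ℂ g f)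

variable {ξ : ℝ} {W : (I → ℝ) → H ≃ₗᵢ[ℂ] H} {U : N → H ≃ₗᵢ[ℂ] H} {χ : N ≃ (I → ℤ)}

namespace IsDualPair

variable (hp : IsDualPair ξ W U χ)
include hp

/-- Unitarity of U ν and the commutation relation absorb a character into the short-time Fourier
transform. -/
theorem mFourier_mul_inner (ν : N) (s : I → ℝ) (f h : H) :
    mFourier (χ ν) (torusMk s) * inner ℂ (W s f) h = inner ℂ (W s (U ν f)) (U ν h) := by
  rw [← (U ν).inner_map_map (W s f) h, hp.commute, inner_smul_left, ← mul_assoc,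
    mFourier_mul_conj, one_mul]

theorem conj_mFourier_mul_inner (ν : N) (s : I → ℝ) (f h : H) :
    conj (mFourier (χ ν) (torusMk s)) * inner ℂ h (W s f) = inner ℂ (U ν h) (W s (U ν f)) := by
  have h1 := congrArg conj (hp.mFourier_mul_inner ν s f h)
  rwa [map_mul, inner_conj_symm, inner_conj_symm] at h1

theorem integrable_norm_sq (f h : H) : Integrable fun s => ‖(inner ℂ (W s f) h : ℂ)‖ ^ 2 := by
  refine (hp.integrable f h h f).norm.congr (Filter.Eventually.of_forall fun s => ?_)
  simp only [norm_mul]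
  rw [norm_inner_symm h, sq]

/-- Expanding the square, each character is absorbed into an inner product, after which
orthogonality evaluates every term. The result is the quadratic form of an entrywise product of two
Gram matrices. -/
theorem integral_polynomial (f h : H) (c : N →₀ ℂ) :
    ((∫ s, ‖∑ ν ∈ c.support, c ν * mFourier (χ ν) (torusMk s)‖ ^ 2
      * ‖(inner ℂ (W s f) h : ℂ)‖ ^ 2 : ℝ) : ℂ)
      = ξ * ∑ i ∈ c.support, ∑ j ∈ c.support,
        star (c i) * (inner ℂ (U i h) (U j h) * inner ℂ (U j f) (U i f)) * c j := by
  rw [← integral_complex_ofReal]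
  have h1 : ∀ s, ((‖∑ ν ∈ c.support, c ν * mFourier (χ ν) (torusMk s)‖ ^ 2
      * ‖(inner ℂ (W s f) h : ℂ)‖ ^ 2 : ℝ) : ℂ)
      = ∑ i ∈ c.support, ∑ j ∈ c.support, (star (c i) * c j) *
        (inner ℂ (W s (U j f)) (U j h) * inner ℂ (U i h) (W s (U i f))) := by
    intro s
    have h2 : ((‖∑ ν ∈ c.support, c ν * mFourier (χ ν) (torusMk s)‖ ^ 2
        * ‖(inner ℂ (W s f) h : ℂ)‖ ^ 2 : ℝ) : ℂ)
        = conj (∑ ν ∈ c.support, c ν * mFourier (χ ν) (torusMk s)) *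
          (∑ ν ∈ c.support, c ν * mFourier (χ ν) (torusMk s)) *
          (inner ℂ h (W s f) * inner ℂ (W s f) h) := by
      rw [← inner_conj_symm h (W s f), ← Complex.normSq_eq_conj_mul_self,
        ← Complex.normSq_eq_conj_mul_self, Complex.normSq_eq_norm_sq, Complex.normSq_eq_norm_sq]
      push_cast; rfl
    rw [h2, map_sum, Finset.sum_mul_sum, Finset.sum_mul]
    refine Finset.sum_congr rfl fun i _ => ?_
    rw [Finset.sum_mul]
    refine Finset.sum_congr rfl fun j _ => ?_
    rw [← hp.mFourier_mul_inner j, ← hp.conj_mFourier_mul_inner i, map_mul, starRingEnd_apply (c i)]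
    ring
  simp only [h1]
  rw [integral_finsetSum _ fun i _ => integrable_finsetSum _ fun j _ =>
    (hp.integrable _ _ _ _).const_mul _, Finset.mul_sum]
  refine Finset.sum_congr rfl fun i _ => ?_
  rw [integral_finsetSum _ fun j _ => (hp.integrable _ _ _ _).const_mul _, Finset.mul_sum]
  refine Finset.sum_congr rfl fun j _ => ?_
  rw [integral_const_mul, hp.orthogonality]
  ring

/-- Linear combinations of the bounds of the Riesz inequalities of `U ν f` pass to the integrals
of the short-time Fourier transform against squares of periodic functions. -/
theorem riesz_integral_bound {f : H} {a b : ℝ}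
    (hpos : ∀ (F : Finset N) (c : N → ℂ),
      0 ≤ a * ‖∑ j ∈ F, c j • U j f‖ ^ 2 + b * ∑ j ∈ F, ‖c j‖ ^ 2) (h : H) (c : N →₀ ℂ) :
    0 ≤ a * (∫ s, ‖∑ ν ∈ c.support, c ν * mFourier (χ ν) (torusMk s)‖ ^ 2
        * ‖(inner ℂ (W s f) h : ℂ)‖ ^ 2)
      + b * (ξ * ‖h‖ ^ 2 * ∫ s in cube I, ‖∑ ν ∈ c.support, c ν * mFourier (χ ν) (torusMk s)‖ ^ 2) := by
  rw [setIntegral_cube_polynomial]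
  have h1 := hp.integral_polynomial f h c
  set Y := ∫ s, ‖∑ ν ∈ c.support, c ν * mFourier (χ ν) (torusMk s)‖ ^ 2
        * ‖(inner ℂ (W s f) h : ℂ)‖ ^ 2
  have hξ : (ξ : ℂ) ≠ 0 := by exact_mod_cast hp.pos.ne'
  have h2 := tensor_form_nonneg (e := fun ν => U ν f) (h := fun ν => U ν h) (β := ‖h‖)
    (fun ν => (U ν).norm_map h) hpos c (X := Y / ξ) (by
      rw [Complex.ofReal_div, h1]; field_simp)
  have h3 := mul_nonneg hp.pos.le h2
  have : ξ * (a * (Y / ξ) + b * (‖h‖ ^ 2 * ∑ j ∈ c.support, ‖c j‖ ^ 2))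
      = a * Y + b * (ξ * ‖h‖ ^ 2 * ∑ j ∈ c.support, ‖c j‖ ^ 2) := by
    have := hp.pos.ne'
    field_simp
  rwa [this] at h3

end IsDualPair

end Duality

/-! ### Frame bounds and the fundamental identity by periodization -/

section Duality

open ContinuousLinearMap UnitAddTorus ComplexConjugate

variable {H : Type*} [NormedAddCommGroup H] [InnerProductSpace ℂ H]
variable {I N : Type*} [Fintype I] [AddCommGroup N]
variable {ξ : ℝ} {W : (I → ℝ) → H ≃ₗᵢ[ℂ] H} {U : N → H ≃ₗᵢ[ℂ] H} {χ : N ≃ (I → ℤ)}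

/-- The integer point `k` of `ℝ^I`. -/
def intPoint (k : I → ℤ) : I → ℝ := fun i => (k i : ℝ)

namespace IsDualPair

variable (hp : IsDualPair ξ W U χ)
include hp

theorem riesz_integral_bound_continuous {f : H} {a b : ℝ}
    (hpos : ∀ (F : Finset N) (c : N → ℂ),
      0 ≤ a * ‖∑ j ∈ F, c j • U j f‖ ^ 2 + b * ∑ j ∈ F, ‖c j‖ ^ 2) (h : H)
    (η : C(UnitAddTorus I, ℂ)) :
    0 ≤ a * (∫ s, ‖η (torusMk s)‖ ^ 2 * ‖(inner ℂ (W s f) h : ℂ)‖ ^ 2)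
      + b * (ξ * ‖h‖ ^ 2) * ∫ s in cube I, ‖η (torusMk s)‖ ^ 2 := by
  have hint := hp.integrable_norm_sq f h
  have hmeas : Continuous fun s => ‖(inner ℂ (W s f) h : ℂ)‖ ^ 2 :=
    ((hp.continuous_shift f).inner continuous_const).norm.pow 2
  -- This measure is finite by square integrability, so density of trigonometric polynomials applies
  -- to it and Lebesgue measure on the cube.
  set μ : Measure (I → ℝ) := volume.withDensity fun s => ENNReal.ofReal (‖(inner ℂ (W s f) h : ℂ)‖ ^ 2)
  have : IsFiniteMeasure μ := isFiniteMeasure_withDensity_ofReal hint.2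
  have hμ : ∀ η : C(UnitAddTorus I, ℂ), ∫ s, ‖η (torusMk s)‖ ^ 2 ∂μ
      = ∫ s, ‖η (torusMk s)‖ ^ 2 * ‖(inner ℂ (W s f) h : ℂ)‖ ^ 2 := by
    intro η
    rw [integral_withDensity_eq_integral_toReal_smul hmeas.measurable.ennreal_ofReal
      (Filter.Eventually.of_forall fun _ => ENNReal.ofReal_lt_top)]
    refine integral_congr_ae (Filter.Eventually.of_forall fun s => ?_)
    dsimp only
    rw [ENNReal.toReal_ofReal (by positivity), smul_eq_mul, mul_comm]
  rw [← hμ]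
  refine nonneg_integral_norm_sq_of_span (fun η hη => ?_) η
  obtain ⟨c, hc⟩ := exists_finsupp_of_mem_span χ hη
  rw [hμ]
  simp only [hc]
  have := hp.riesz_integral_bound hpos h c
  linarith

theorem continuous_symm (h : H) : Continuous fun s => (W s).symm h := by
  rw [continuous_iff_continuousAt]
  intro s₀
  rw [ContinuousAt, tendsto_iff_dist_tendsto_zero]
  have h1 : ∀ s, dist ((W s).symm h) ((W s₀).symm h)
      = dist (W s ((W s₀).symm h)) (W s₀ ((W s₀).symm h)) := by
    intro s
    rw [← (W s).dist_map, (W s).apply_symm_apply, (W s₀).apply_symm_apply, dist_comm]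
  simp only [h1]
  exact tendsto_iff_dist_tendsto_zero.mp (hp.continuous_shift _).continuousAt

/-- The unimodular factor of `shift_add` occurs once conjugated and once not, so it cancels. -/
theorem shift_intPoint_inner_mul (f g h k : H) (s : I → ℝ) (m : I → ℤ) :
    (inner ℂ (W (s + intPoint m) g) k * inner ℂ h (W (s + intPoint m) f) : ℂ)
      = inner ℂ (W (intPoint m) g) ((W s).symm k) * inner ℂ ((W s).symm h) (W (intPoint m) f) := by
  obtain ⟨c, hc, h1⟩ := hp.shift_add s (intPoint m)
  have h2 : conj c * c = 1 := by
    rw [← Complex.normSq_eq_conj_mul_self, Complex.normSq_eq_norm_sq, hc]; simp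
  rw [h1, h1, inner_smul_left, inner_smul_right, ← (W s).inner_map_map _ ((W s).symm k),
    ← (W s).inner_map_map ((W s).symm h), (W s).apply_symm_apply, (W s).apply_symm_apply,
    mul_mul_mul_comm, h2, one_mul]

/-- No frame operator is available yet, so the localization at 0 is applied to finite partial sums
of the periodization, which are continuous. -/
theorem isBessel_shift {f : H} {B : ℝ}
    (hB : ∀ (F : Finset N) (c : N → ℂ), ‖∑ j ∈ F, c j • U j f‖ ^ 2 ≤ B * ∑ j ∈ F, ‖c j‖ ^ 2) :
    IsBessel (fun k : I → ℤ => W (intPoint k) f) (ξ * B) := by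
  intro h F
  have hc : ∀ k : I → ℤ, Continuous fun s => ‖(inner ℂ (W (s + intPoint k) f) h : ℂ)‖ ^ 2 := fun k =>
    ((((hp.continuous_shift f).comp (continuous_add_const (intPoint k))).inner continuous_const).norm.pow 2)
  have key := nonneg_of_setIntegral_cube
    (u := fun s => ξ * B * ‖h‖ ^ 2 - ∑ k ∈ F, ‖(inner ℂ (W (s + intPoint k) f) h : ℂ)‖ ^ 2)
    (continuous_const.sub (continuous_finsetSum _ fun k _ => hc k)) fun η => ?_
  · simpa [sub_nonneg] using key
  have hη : Continuous fun s : I → ℝ => ‖η (torusMk s)‖ ^ 2 :=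
    (η.continuous.comp continuous_torusMk).norm.pow 2
  have hintF : Integrable fun s => ‖η (torusMk s)‖ ^ 2 * ‖(inner ℂ (W s f) h : ℂ)‖ ^ 2 := by
    refine (hp.integrable_norm_sq f h).bdd_mul (c := ‖η‖ ^ 2) hη.aestronglyMeasurable
      (Filter.Eventually.of_forall fun s => ?_)
    rw [Real.norm_of_nonneg (by positivity)]
    gcongr
    exact η.norm_coe_le_norm _
  have h1 := hp.riesz_integral_bound_continuous (f := f) (a := -1) (b := B)
    (fun F c => by linarith [hB F c]) h η
  have h2 := hasSum_setIntegral_cube hintF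
  have h3 : ∑ k ∈ F, ∫ s in cube I, ‖η (torusMk s)‖ ^ 2 * ‖(inner ℂ (W (s + intPoint k) f) h : ℂ)‖ ^ 2
      ≤ ∫ s, ‖η (torusMk s)‖ ^ 2 * ‖(inner ℂ (W s f) h : ℂ)‖ ^ 2 := by
    refine le_trans (le_of_eq ?_) (sum_le_hasSum F (fun k _ => integral_nonneg fun s => by positivity) h2)
    refine Finset.sum_congr rfl fun k _ => ?_
    simp only [torusMk_add_int]
    rfl
  have h4 : ∫ s in cube I, ‖η (torusMk s)‖ ^ 2 *
      (ξ * B * ‖h‖ ^ 2 - ∑ k ∈ F, ‖(inner ℂ (W (s + intPoint k) f) h : ℂ)‖ ^ 2)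
      = (ξ * B * ‖h‖ ^ 2) * (∫ s in cube I, ‖η (torusMk s)‖ ^ 2) -
        ∑ k ∈ F, ∫ s in cube I, ‖η (torusMk s)‖ ^ 2 * ‖(inner ℂ (W (s + intPoint k) f) h : ℂ)‖ ^ 2 := by
    have hk : ∀ k ∈ F, IntegrableOn (fun s => ‖η (torusMk s)‖ ^ 2 *
        ‖(inner ℂ (W (s + intPoint k) f) h : ℂ)‖ ^ 2) (cube I) := fun k _ =>
      integrableOn_cube (hη.mul (hc k))
    rw [← integral_finsetSum _ hk, ← integral_const_mul, ← integral_sub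
      ((integrableOn_cube hη).const_mul _) (integrable_finsetSum _ hk)]
    refine integral_congr_ae (Filter.Eventually.of_forall fun s => ?_)
    dsimp only
    rw [mul_sub, Finset.mul_sum]; ring
  rw [h4]
  linarith

theorem continuous_periodization (S : H →L[ℂ] H) (h k : H) :
    Continuous fun s => (inner ℂ ((W s).symm h) (S ((W s).symm k)) : ℂ) :=
  (hp.continuous_symm h).inner (S.continuous.comp (hp.continuous_symm k))

theorem periodization_zero (S : H →L[ℂ] H) (h k : H) :
    (inner ℂ ((W 0).symm h) (S ((W 0).symm k)) : ℂ) = inner ℂ h (S k) := by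
  have : ∀ x, (W 0).symm x = x := fun x => by
    conv_lhs => rw [← hp.shift_zero x]
    exact (W 0).symm_apply_apply x
  rw [this, this]

section FrameOperator

variable {f : H} {S : H →L[ℂ] H}
  (hS : IsFrameOperator (fun k : I → ℤ => W (intPoint k) f) S)
include hS

theorem hasSum_periodization (h k : H) (s : I → ℝ) :
    HasSum (fun m : I → ℤ => (inner ℂ (W (s + intPoint m) f) k * inner ℂ h (W (s + intPoint m) f) : ℂ))
      (inner ℂ ((W s).symm h) (S ((W s).symm k))) := by
  have h1 := (hS ((W s).symm k)).mapL (innerSL ℂ ((W s).symm h))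
  simp only [innerSL_apply_apply, inner_smul_right] at h1
  simpa only [hp.shift_intPoint_inner_mul] using h1

/-- Unfolding against a periodic continuous function. -/
theorem integral_mul_eq_setIntegral_periodization (h k : H) (η : C(UnitAddTorus I, ℂ)) :
    ∫ s, η (torusMk s) * (inner ℂ (W s f) k * inner ℂ h (W s f))
      = ∫ s in cube I, η (torusMk s) * inner ℂ ((W s).symm h) (S ((W s).symm k)) := by
  have hint : Integrable fun s => η (torusMk s) * (inner ℂ (W s f) k * inner ℂ h (W s f) : ℂ) :=
    (hp.integrable f k h f).bdd_mul (c := ‖η‖)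
      (η.continuous.comp continuous_torusMk).aestronglyMeasurable
      (Filter.Eventually.of_forall fun s => η.norm_coe_le_norm _)
  rw [integral_eq_setIntegral_tsum hint]
  refine setIntegral_congr_fun measurableSet_cube fun s _ => ?_
  simp only [torusMk_add_int]
  exact ((hp.hasSum_periodization hS h k s).mul_left _).tsum_eq

theorem lower_frame_bound {A : ℝ}
    (hA : ∀ (F : Finset N) (c : N → ℂ), A * ∑ j ∈ F, ‖c j‖ ^ 2 ≤ ‖∑ j ∈ F, c j • U j f‖ ^ 2) (h : H) :
    ξ * A * ‖h‖ ^ 2 ≤ (inner ℂ h (S h) : ℂ).re := by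
  have hc := hp.continuous_periodization S h h
  have key := nonneg_of_setIntegral_cube
    (u := fun s => (inner ℂ ((W s).symm h) (S ((W s).symm h)) : ℂ).re - ξ * A * ‖h‖ ^ 2)
    ((Complex.continuous_re.comp hc).sub continuous_const) fun η => ?_
  · rw [hp.periodization_zero S] at key
    linarith
  have hη : Continuous fun s : I → ℝ => ‖η (torusMk s)‖ ^ 2 :=
    (η.continuous.comp continuous_torusMk).norm.pow 2
  have h1 := hp.riesz_integral_bound_continuous (f := f) (a := 1) (b := -A)
    (fun F c => by linarith [hA F c]) h η
  -- The weight |η|² as a complex function, the form required by the unfolding identity.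
  let η2 : C(UnitAddTorus I, ℂ) := ⟨fun x => ((‖η x‖ ^ 2 : ℝ) : ℂ), by fun_prop⟩
  have h2 := hp.integral_mul_eq_setIntegral_periodization hS h h η2
  have h3 : ∫ s, ‖η (torusMk s)‖ ^ 2 * ‖(inner ℂ (W s f) h : ℂ)‖ ^ 2
      = ∫ s in cube I, ‖η (torusMk s)‖ ^ 2 * (inner ℂ ((W s).symm h) (S ((W s).symm h)) : ℂ).re := by
    have e1 : ∀ s, η2 (torusMk s) * (inner ℂ (W s f) h * inner ℂ h (W s f))
        = ((‖η (torusMk s)‖ ^ 2 * ‖(inner ℂ (W s f) h : ℂ)‖ ^ 2 : ℝ) : ℂ) := by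
      intro s
      rw [← inner_conj_symm h (W s f), Complex.mul_conj, Complex.normSq_eq_norm_sq]
      simp [η2]
    simp only [e1] at h2
    rw [integral_complex_ofReal] at h2
    have h4 := congrArg Complex.re h2
    rw [Complex.ofReal_re] at h4
    rw [h4]
    have hi : IntegrableOn (fun s => η2 (torusMk s) *
        (inner ℂ ((W s).symm h) (S ((W s).symm h)) : ℂ)) (cube I) :=
      integrableOn_cube ((η2.continuous.comp continuous_torusMk).mul hc)
    refine (integral_re hi).symm.trans
      (integral_congr_ae (Filter.Eventually.of_forall fun s => ?_))
    simp [η2, -Complex.ofReal_pow]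
  have h5 : ∫ s in cube I, ‖η (torusMk s)‖ ^ 2 *
      ((inner ℂ ((W s).symm h) (S ((W s).symm h)) : ℂ).re - ξ * A * ‖h‖ ^ 2)
      = (∫ s in cube I, ‖η (torusMk s)‖ ^ 2 * (inner ℂ ((W s).symm h) (S ((W s).symm h)) : ℂ).re)
        - (ξ * A * ‖h‖ ^ 2) * ∫ s in cube I, ‖η (torusMk s)‖ ^ 2 := by
    have hi : IntegrableOn (fun s => ‖η (torusMk s)‖ ^ 2 *
        (inner ℂ ((W s).symm h) (S ((W s).symm h)) : ℂ).re) (cube I) :=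
      integrableOn_cube (hη.mul (Complex.continuous_re.comp hc))
    rw [← integral_const_mul, ← integral_sub hi ((integrableOn_cube hη).const_mul _)]
    refine integral_congr_ae (Filter.Eventually.of_forall fun s => ?_)
    dsimp only
    ring
  rw [h5, ← h3]
  linarith

/-- The fundamental identity of Gabor analysis. -/
theorem hasSum_adjoint_series {x h : H}
    (hsum : Summable fun ν => (inner ℂ (U ν x) h * inner ℂ f (U ν f) : ℂ)) :
    HasSum (fun ν => (ξ : ℂ) * (inner ℂ (U ν x) h * inner ℂ f (U ν f))) (inner ℂ x (S h)) := by
  have hcoef : ∀ ν, ∫ s in cube I, conj (mFourier (χ ν) (torusMk s)) *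
      inner ℂ ((W s).symm x) (S ((W s).symm h)) = ξ * (inner ℂ (U ν x) h * inner ℂ f (U ν f)) := by
    intro ν
    have h1 := hp.integral_mul_eq_setIntegral_periodization hS x h (mFourier (-(χ ν)))
    simp only [mFourier_neg] at h1
    rw [← h1, ← hp.orthogonality]
    refine integral_congr_ae (Filter.Eventually.of_forall fun s => ?_)
    dsimp only
    rw [mul_left_comm, hp.conj_mFourier_mul_inner]
  -- Periodicity comes from reindexing the sum over integer points.
  have hper : ∀ s (k : I → ℤ), (inner ℂ ((W (s + fun i => (k i : ℝ))).symm x)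
      (S ((W (s + fun i => (k i : ℝ))).symm h)) : ℂ) = inner ℂ ((W s).symm x) (S ((W s).symm h)) := by
    intro s k
    have h1 := hp.hasSum_periodization hS x h (s + intPoint k)
    have h2 := (Equiv.hasSum_iff (Equiv.addLeft k)).mpr (hp.hasSum_periodization hS x h s)
    refine h1.unique (h2.congr_fun fun m => ?_)
    have : s + intPoint (Equiv.addLeft k m) = s + intPoint k + intPoint m := by
      ext i; simp [intPoint, add_assoc]
    simp only [Function.comp_apply, this]
  have h3 := hasSum_fourier_of_periodic (hp.continuous_periodization S x h) hper (by
    rw [← χ.summable_iff]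
    refine (hsum.mul_left (ξ : ℂ)).congr fun ν => ?_
    simp only [Function.comp_apply, hcoef])
  rw [← χ.hasSum_iff, hp.periodization_zero S] at h3
  refine h3.congr_fun fun ν => ?_
  simp only [Function.comp_apply, hcoef]

end FrameOperator

end IsDualPair

end Duality

/-! ### Commuting frame operators and the abstract theorem -/

section Duality

open ContinuousLinearMap UnitAddTorus ComplexConjugate

variable {H : Type*} [NormedAddCommGroup H] [InnerProductSpace ℂ H]
variable {I N : Type*} [Fintype I] [AddCommGroup N]
variable {ξ : ℝ} {W : (I → ℝ) → H ≃ₗᵢ[ℂ] H} {U : N → H ≃ₗᵢ[ℂ] H} {χ : N ≃ (I → ℤ)}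

namespace IsDualPair

variable (hp : IsDualPair ξ W U χ)
include hp

theorem norm_inner_adjoint_add (ν μ : N) (f h : H) :
    ‖(inner ℂ (U (ν + μ) f) h : ℂ)‖ = ‖(inner ℂ (U ν (U μ f)) h : ℂ)‖ := by
  obtain ⟨c, hc, h1⟩ := hp.adjoint_add ν μ
  rw [h1, inner_smul_left, norm_mul, RCLike.norm_conj, hc, one_mul]

/-- The frame operator of the orbit of `f` under the adjoint shifts commutes with these shifts. -/
theorem frameOperator_adjoint_apply {f : H} {F : H →L[ℂ] H}
    (hF : IsFrameOperator (fun ν => U ν f) F) (ν : N) (h : H) : F (U ν h) = U ν (F h) := by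
  have h1 := (Equiv.hasSum_iff (Equiv.addLeft ν)).mpr (hF (U ν h))
  have h2 := (hF h).mapL (U ν : H →L[ℂ] H)
  refine h1.unique (h2.congr_fun fun μ => ?_)
  obtain ⟨c, hc, hadd⟩ := hp.adjoint_add ν μ
  have h3 : conj c * c = 1 := by
    rw [← Complex.normSq_eq_conj_mul_self, Complex.normSq_eq_norm_sq, hc]; simp
  simp only [Function.comp_apply, Equiv.coe_addLeft, hadd, inner_smul_left,
    (U ν).inner_map_map, smul_smul, map_smul, mul_right_comm _ _ c, h3, one_mul]
  rfl

/-- In the fundamental identity F can be moved from one argument to the other, because it commutes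
with each U ν. Absolute convergence is known on the orbit of f, so the identity first gives F S = S
F on the range of C. -/
theorem commute_frameOperators [CompleteSpace H] {f : H} {B : ℝ} (hB : IsBessel (fun ν => U ν f) B)
    {F S : H →L[ℂ] H} (hF : IsFrameOperator (fun ν => U ν f) F)
    (hS : IsFrameOperator (fun k : I → ℤ => W (intPoint k) f) S)
    (hF0 : F.IsPositive) (hS0 : S.IsPositive) {C : ell2 N →L[ℂ] H}
    (hC : ∀ ν, C (unitVec ν) = U ν f) (hFC : C ∘L adjoint C = F) : Commute F S := by
  have hFsymm : ∀ x y, (inner ℂ (F x) y : ℂ) = inner ℂ x (F y) := hF0.isSymmetric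
  have hSsymm : ∀ x y, (inner ℂ (S x) y : ℂ) = inner ℂ x (S y) := hS0.isSymmetric
  have ha : Summable fun ν => ‖(inner ℂ f (U ν f) : ℂ)‖ ^ 2 :=
    (hB.summable f).congr fun ν => by rw [norm_inner_symm]
  have hsum : ∀ x h, (Summable fun ν => ‖(inner ℂ (U ν x) h : ℂ)‖ ^ 2) →
      Summable fun ν => (inner ℂ (U ν x) h * inner ℂ f (U ν f) : ℂ) := fun x h hx => by
    refine Summable.of_norm_bounded (hx.add ha) fun ν => ?_
    rw [norm_mul]
    nlinarith [sq_nonneg (‖(inner ℂ (U ν x) h : ℂ)‖ - ‖(inner ℂ f (U ν f) : ℂ)‖),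
      sq_nonneg (‖(inner ℂ (U ν x) h : ℂ)‖), sq_nonneg ‖(inner ℂ f (U ν f) : ℂ)‖]
  have horbit : ∀ μ h, Summable fun ν => ‖(inner ℂ (U ν (U μ f)) h : ℂ)‖ ^ 2 := fun μ h => by
    refine ((Equiv.summable_iff (Equiv.addRight μ)).mpr (hB.summable h)).congr fun ν => ?_
    simp only [Function.comp_apply, Equiv.coe_addRight, hp.norm_inner_adjoint_add]
  have hUF : ∀ ν x h, (inner ℂ (U ν (F x)) h : ℂ) = inner ℂ (U ν x) (F h) := fun ν x h => by
    rw [← hp.frameOperator_adjoint_apply hF, hFsymm]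
  have hcomm : ∀ μ, F (S (U μ f)) = S (F (U μ f)) := by
    intro μ
    refine ext_inner_right ℂ fun h => ?_
    rw [hFsymm, hSsymm, hSsymm]
    have h1 := hp.hasSum_adjoint_series hS (hsum (U μ f) (F h) (horbit μ (F h)))
    have h2 := hp.hasSum_adjoint_series hS (hsum (F (U μ f)) h
      ((horbit μ (F h)).congr fun ν => by rw [hUF]))
    simp only [hUF] at h2
    exact h1.unique h2
  have h1 : F ∘L S ∘L C = S ∘L F ∘L C := clm_ext_unitVec fun μ => by
    simp only [comp_apply, hC, hcomm]
  -- Composing with C* gives FSF = SF²; adjoints give FSF = F²S. So S commutes with F², and with F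
  -- as the square root of F².
  have h2 : F * S * F = S * (F * F) := by
    ext x
    have := congrArg (fun Z : ell2 N →L[ℂ] H => Z (adjoint C x)) h1
    rw [← hFC] at this ⊢
    simpa using this
  have h3 : F * S * F = F * F * S := by
    have h4 := congrArg star h2
    have hFs : star F = F := hF0.isSelfAdjoint
    have hSs : star S = S := hS0.isSelfAdjoint
    simpa only [star_mul, hFs, hSs, mul_assoc] using h4
  have h4 : Commute (F * F) S := h3.symm.trans h2
  have h5 := commute_sqrt h4
  rwa [CFC.sqrt_mul_self F ((nonneg_iff_isPositive F).mpr hF0)] at h5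

theorem frameOperator_apply_generator [CompleteSpace H] {f : H} {T : H →L[ℂ] ell2 N}
    (hT : ∀ h ν, T h ν = inner ℂ (U ν f) h) {S : H →L[ℂ] H}
    (hS : IsFrameOperator (fun k : I → ℤ => W (intPoint k) f) S) (hS0 : S.IsPositive) :
    S f = (ξ : ℂ) • adjoint T (T f) := by
  have hSsymm : ∀ x y, (inner ℂ (S x) y : ℂ) = inner ℂ x (S y) := hS0.isSymmetric
  refine ext_inner_right ℂ fun h => ?_
  rw [hSsymm, inner_smul_left, adjoint_inner_left, Complex.conj_ofReal]
  have h1 := lp.hasSum_inner (𝕜 := ℂ) (T f) (T h)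
  have h2 : (fun ν => (inner ℂ (T f ν) (T h ν) : ℂ))
      = fun ν => inner ℂ (U ν f) h * inner ℂ f (U ν f) := by
    ext ν
    rw [RCLike.inner_apply, hT, hT, inner_conj_symm]
  rw [h2] at h1
  exact (hp.hasSum_adjoint_series hS h1.summable).unique (h1.mul_left _)

/-- The duality principle together with the identification of the symmetric orthogonalization of
the adjoint system with the canonical tight window. -/
theorem exists_gram_frame_orthonormal [CompleteSpace H] {f : H} {A B : ℝ} (hA : 0 < A) (hB : 0 < B)
    (hriesz : ∀ (F : Finset N) (c : N → ℂ), A * ∑ j ∈ F, ‖c j‖ ^ 2 ≤ ‖∑ j ∈ F, c j • U j f‖ ^ 2 ∧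
      ‖∑ j ∈ F, c j • U j f‖ ^ 2 ≤ B * ∑ j ∈ F, ‖c j‖ ^ 2) :
    ∃ (R : ell2 N →L[ℂ] ell2 N) (S : H →L[ℂ] H) (φ : H),
      (IsGramOperator (fun ν => U ν f) R ∧ R.IsPositive ∧ IsUnit R) ∧
      (IsFrameOperator (fun k : I → ℤ => W (intPoint k) f) S ∧ S.IsPositive ∧ IsUnit S) ∧
      HasSum (fun ν => entry (invSqrt R) ν 0 • U ν f) φ ∧
      φ = (√ξ : ℂ) • invSqrt S f ∧ Orthonormal ℂ fun ν => U ν φ := by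
  classical
  have hBessel := isBessel_of_synthesis_le hB fun F c => (hriesz F c).2
  obtain ⟨T, hT⟩ := hBessel.exists_analysis
  set C := adjoint T with hC
  have hCT : adjoint C = T := adjoint_adjoint T
  have hCu : ∀ ν, C (unitVec ν) = U ν f := adjoint_analysis_unitVec hT
  set R := adjoint C ∘L C with hR
  have hR0 : R.IsPositive := isPositive_adjoint_comp_self C
  have hRu : IsUnit R := isUnit_adjoint_comp_self C hA
    (le_norm_adjoint_analysis hT fun F c => (hriesz F c).1)
  obtain ⟨TW, hTW⟩ := (hp.isBessel_shift fun F c => (hriesz F c).2).exists_analysis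
  set S := adjoint TW ∘L TW with hSdef
  have hS : IsFrameOperator (fun k : I → ℤ => W (intPoint k) f) S := isFrameOperator_of_analysis hTW
  have hS0 : S.IsPositive := isPositive_adjoint_comp_self TW
  have hSu : IsUnit S := by
    refine isUnit_adjoint_comp_self TW (mul_pos hp.pos hA) fun x => ?_
    have h1 := hp.lower_frame_bound hS (fun F c => (hriesz F c).1) x
    rw [hSdef, comp_apply, adjoint_inner_right, inner_self_eq_norm_sq_to_K] at h1
    simpa [← Complex.ofReal_pow] using h1
  have hRs := isStrictlyPositive_of_isPositive hR0 hRu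
  have hSs := isStrictlyPositive_of_isPositive hS0 hSu
  have hF : IsFrameOperator (fun ν => U ν f) (C ∘L adjoint C) := by
    rw [hCT]; exact isFrameOperator_of_analysis hT
  have hcomm : Commute (C ∘L adjoint C) S :=
    hp.commute_frameOperators hBessel hF hS (isPositive_self_comp_adjoint C) hS0 hCu rfl
  have hC0 : C (unitVec 0) = f := by rw [hCu, hp.adjoint_zero]
  have hpolar : C (invSqrt R (unitVec 0)) = (√ξ : ℂ) • invSqrt S (C (unitVec 0)) := by
    refine polar_apply_eq hRs hp.pos hSs hcomm ?_
    rw [hC0, hCT]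
    exact hp.frameOperator_apply_generator hT hS hS0
  have hUφ : ∀ ν, U ν (C (invSqrt R (unitVec 0))) = C (invSqrt R (unitVec ν)) := by
    intro ν
    refine apply_polar_eq (V := (U ν : H →L[ℂ] H)) hRs ?_ ?_
    · ext x
      exact hp.frameOperator_adjoint_apply hF ν x
    · rw [hC0, hCu]
      rfl
  refine ⟨R, S, C (invSqrt R (unitVec 0)), ⟨?_, hR0, hRu⟩, ⟨hS, hS0, hSu⟩, ?_, ?_, ?_⟩
  · rw [hR, hCT]
    exact isGramOperator_of_analysis hT
  · exact hasSum_adjoint_analysis hT (invSqrt R (unitVec 0))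
  · rw [hpolar, hC0]
  · rw [orthonormal_iff_ite]
    intro ν μ
    have h1 := congrArg (fun Z : ell2 N →L[ℂ] ell2 N => Z (unitVec μ)) (sqrt_mul_invSqrt hRs).2.2
    have h2 : invSqrt R (adjoint C (C (invSqrt R (unitVec μ)))) = unitVec μ := by simpa [hR] using h1
    rw [hUφ, hUφ, ← adjoint_inner_right, ← adjoint_inner_right, isSelfAdjoint_invSqrt, h2,
      inner_unitVec, unitVec_apply]

end IsDualPair

end Duality

/-! ### Plancherel's theorem for the Fourier integral -/

section Plancherel

open FourierTransform

variable {V : Type*} [NormedAddCommGroup V] [InnerProductSpace ℝ V] [FiniteDimensional ℝ V]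
  [MeasurableSpace V] [BorelSpace V]

/-- On `L¹ ∩ L²` the Fourier integral agrees with the Fourier transform of `L²`. -/
theorem fourier_toLp_ae_eq {g : V → ℂ} (h1 : Integrable g) (h2 : MemLp g 2) :
    (𝓕 h2.toLp : Lp ℂ 2 (volume : Measure V)) =ᵐ[volume] 𝓕 g := by
  -- Both sides are tested against smooth compactly supported functions. These are Schwartz, and
  -- moving the transform onto the test function gives the same integral.
  refine ae_eq_of_integral_contDiff_smul_eq ?_ ?_ fun φ hφ hφc => ?_
  · exact (Lp.memLp _).locallyIntegrable one_le_two
  · exact (VectorFourier.fourierIntegral_continuous Real.continuous_fourierChar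
      (by exact continuous_inner) h1).locallyIntegrable
  have hc : HasCompactSupport fun x => (φ x : ℂ) :=
    hφc.comp_left (g := fun r : ℝ => (r : ℂ)) Complex.ofReal_zero
  have hs : ContDiff ℝ (⊤ : ℕ∞) fun x => (φ x : ℂ) := Complex.ofRealCLM.contDiff.comp hφ
  set ψ : SchwartzMap V ℂ := hc.toSchwartzMap hs with hψ
  have hψφ : ∀ x, ψ x = (φ x : ℂ) := fun x => rfl
  have e1 := congrArg (fun T : TemperedDistribution V ℂ => T ψ)
    (Lp.fourier_toTemperedDistribution_eq h2.toLp)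
  simp only [TemperedDistribution.fourier_apply, Lp.toTemperedDistribution_apply] at e1
  have e2 : ∫ x, (𝓕 ψ : SchwartzMap V ℂ) x • (h2.toLp : V → ℂ) x
      = ∫ x, (𝓕 ψ : SchwartzMap V ℂ) x • g x := by
    refine integral_congr_ae ?_
    filter_upwards [h2.coeFn_toLp] with x hx
    rw [hx]
  have e3 : ∫ x, (𝓕 ψ : SchwartzMap V ℂ) x • g x = ∫ x, ψ x • 𝓕 g x := by
    have := VectorFourier.integral_fourierIntegral_smul_eq_flip (μ := (volume : Measure V))
      (ν := (volume : Measure V)) (L := innerₗ V) (f := ψ) (g := g)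
      Real.continuous_fourierChar (by exact continuous_inner) ψ.integrable h1
    rw [flip_innerₗ] at this
    exact this
  rw [e2, e3] at e1
  simp only [hψφ] at e1
  simpa using e1.symm

/-- Plancherel's theorem on `L¹ ∩ L²`. -/
theorem lintegral_enorm_sq_fourier {g : V → ℂ} (h1 : Integrable g) (h2 : MemLp g 2) :
    ∫⁻ w, ‖𝓕 g w‖ₑ ^ 2 = ∫⁻ t, ‖g t‖ₑ ^ 2 := by
  have hn : eLpNorm (𝓕 g) 2 volume = eLpNorm g 2 volume := by
    rw [← eLpNorm_congr_ae (fourier_toLp_ae_eq h1 h2), ← Lp.enorm_def, ← eLpNorm_congr_ae h2.coeFn_toLp,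
      ← Lp.enorm_def, ← ofReal_norm, ← ofReal_norm, Lp.norm_fourier_eq]
  have h := congrArg (· ^ (2 : ℝ)) hn
  simp only [eLpNorm_eq_lintegral_rpow_enorm_toReal two_ne_zero ENNReal.ofNat_ne_top, ENNReal.toReal_ofNat,
    ← ENNReal.rpow_mul] at h
  simpa using h

end Plancherel

/-! ### Commutation relations and strong continuity of time-frequency shifts -/

section Shifts

variable {d : ℕ}

/-- The character `exp (2πi r)`. -/
noncomputable def phase (r : ℝ) : ℂ := Complex.exp (2 * Real.pi * Complex.I * r)

theorem phase_add (r s : ℝ) : phase (r + s) = phase r * phase s := by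
  rw [phase, phase, phase, ← Complex.exp_add]
  push_cast
  ring_nf

theorem norm_phase (r : ℝ) : ‖phase r‖ = 1 := by
  have : (2 * Real.pi * Complex.I * r : ℂ) = ((2 * Real.pi * r : ℝ) : ℂ) * Complex.I := by
    push_cast; ring
  rw [phase, this, Complex.norm_exp_ofReal_mul_I]

theorem phase_zero : phase 0 = 1 := by simp [phase]

theorem conj_phase (r : ℝ) : (starRingEnd ℂ) (phase r) = phase (-r) := by
  rw [phase, phase, ← Complex.exp_conj]
  simp [Complex.conj_ofNat]

theorem continuous_phase : Continuous phase := by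
  unfold phase
  fun_prop

theorem timePart_add (p q : Phase d) : timePart (p + q) = timePart p + timePart q := rfl

theorem freqPart_add (p q : Phase d) : freqPart (p + q) = freqPart p + freqPart q := rfl

theorem modulation_coeFn (w : EuclideanSpace ℝ (Fin d)) (f : L2 d) :
    modulation w f =ᵐ[volume] fun t => f t * phase (inner ℝ w t) :=
  (memLp_modulation w f).coeFn_toLp

theorem translation_coeFn (x : EuclideanSpace ℝ (Fin d)) (f : L2 d) :
    translation x f =ᵐ[volume] fun t => f (t - x) :=
  Lp.coeFn_compMeasurePreserving f _

theorem tfShift_coeFn (p : Phase d) (f : L2 d) :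
    tfShift p f =ᵐ[volume] fun t => f (t - timePart p) *
      phase (inner ℝ (freqPart p) (t - timePart p)) :=
  (translation_coeFn _ _).trans
    ((measurePreserving_sub_right volume (timePart p)).quasiMeasurePreserving.ae_eq_comp
      (modulation_coeFn (freqPart p) f))

theorem modulation_add (w : EuclideanSpace ℝ (Fin d)) (f g : L2 d) :
    modulation w (f + g) = modulation w f + modulation w g := by
  refine Lp.ext ?_
  filter_upwards [modulation_coeFn w (f + g), modulation_coeFn w f, modulation_coeFn w g,
    Lp.coeFn_add f g, Lp.coeFn_add (modulation w f) (modulation w g)] with t h1 h2 h3 h4 h5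
  rw [h1, h5, Pi.add_apply, h2, h3, h4, Pi.add_apply, add_mul]

theorem modulation_smul (w : EuclideanSpace ℝ (Fin d)) (c : ℂ) (f : L2 d) :
    modulation w (c • f) = c • modulation w f := by
  refine Lp.ext ?_
  filter_upwards [modulation_coeFn w (c • f), modulation_coeFn w f,
    Lp.coeFn_smul c f, Lp.coeFn_smul c (modulation w f)] with t h1 h2 h3 h4
  rw [h1, h4, Pi.smul_apply, h2, h3, Pi.smul_apply, smul_eq_mul, smul_eq_mul, mul_assoc]

theorem norm_modulation (w : EuclideanSpace ℝ (Fin d)) (f : L2 d) : ‖modulation w f‖ = ‖f‖ := by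
  rw [Lp.norm_def, Lp.norm_def]
  congr 1
  refine eLpNorm_congr_norm_ae ?_
  filter_upwards [modulation_coeFn w f] with t ht
  rw [ht, norm_mul, norm_phase, mul_one]

/-- The modulation as a linear isometry. -/
noncomputable def modulationIsometry (w : EuclideanSpace ℝ (Fin d)) : L2 d →ₗᵢ[ℂ] L2 d where
  toFun := modulation w
  map_add' := modulation_add w
  map_smul' := modulation_smul w
  norm_map' := norm_modulation w

/-- The time-frequency shift as a linear isometry. -/
noncomputable def tfShiftIsometry (p : Phase d) : L2 d →ₗᵢ[ℂ] L2 d :=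
  (Lp.compMeasurePreservingₗᵢ ℂ (fun t => t - timePart p)
    (measurePreserving_sub_right volume (timePart p))).comp (modulationIsometry (freqPart p))

theorem tfShiftIsometry_apply (p : Phase d) (f : L2 d) : tfShiftIsometry p f = tfShift p f := rfl

theorem tfShift_smul (p : Phase d) (c : ℂ) (f : L2 d) : tfShift p (c • f) = c • tfShift p f :=
  (tfShiftIsometry p).map_smul c f

theorem tfShift_zero (f : L2 d) : tfShift (0 : Phase d) f = f := by
  refine Lp.ext ?_
  filter_upwards [tfShift_coeFn (0 : Phase d) f] with t ht
  have h1 : timePart (0 : Phase d) = 0 := rfl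
  have h2 : freqPart (0 : Phase d) = 0 := rfl
  rw [ht, h1, h2, sub_zero, inner_zero_left, phase_zero, mul_one]

theorem tfShift_add (p q : Phase d) (f : L2 d) :
    tfShift (p + q) f = phase (-inner ℝ (freqPart p) (timePart q)) • tfShift p (tfShift q f) := by
  refine Lp.ext ?_
  filter_upwards [tfShift_coeFn (p + q) f, tfShift_coeFn p (tfShift q f),
    (measurePreserving_sub_right volume (timePart p)).quasiMeasurePreserving.ae_eq_comp
      (tfShift_coeFn q f),
    Lp.coeFn_smul (phase (-inner ℝ (freqPart p) (timePart q))) (tfShift p (tfShift q f))]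
    with t h1 h2 h3 h4
  simp only [Function.comp_apply] at h3
  have h5 : t - (timePart p + timePart q) = t - timePart p - timePart q := by abel
  rw [h1, h4, Pi.smul_apply, h2, h3, timePart_add, freqPart_add, smul_eq_mul, h5, mul_assoc (f _),
    mul_left_comm (phase _) (f _), ← phase_add, ← phase_add]
  congr 2
  rw [inner_add_left, inner_sub_right (freqPart p) (t - timePart p)]
  ring

theorem tfShift_comm (p q : Phase d) (f : L2 d) :
    tfShift p (tfShift q f) = phase (inner ℝ (freqPart p) (timePart q) -
      inner ℝ (freqPart q) (timePart p)) • tfShift q (tfShift p f) := by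
  have h1 := tfShift_add p q f
  have h2 := tfShift_add q p f
  rw [add_comm q p, h1] at h2
  have h3 := congrArg (fun g => phase (inner ℝ (freqPart p) (timePart q)) • g) h2
  simp only [smul_smul, ← phase_add] at h3
  rw [add_neg_cancel, phase_zero, one_smul] at h3
  rw [h3, sub_eq_add_neg]

theorem tfShift_surjective (p : Phase d) : Function.Surjective (tfShiftIsometry p) := fun f =>
  ⟨phase (-inner ℝ (freqPart p) (timePart (-p))) • tfShift (-p) f, by
    rw [tfShiftIsometry_apply, tfShift_smul, ← tfShift_add, add_neg_cancel, tfShift_zero]⟩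

/-- The time-frequency shift as a unitary operator. -/
noncomputable def tfShiftEquiv (p : Phase d) : L2 d ≃ₗᵢ[ℂ] L2 d :=
  LinearIsometryEquiv.ofSurjective (tfShiftIsometry p) (tfShift_surjective p)

theorem tfShiftEquiv_apply (p : Phase d) (f : L2 d) : tfShiftEquiv p f = tfShift p f := rfl

theorem integrable_mul_conj (f g : L2 d) :
    Integrable fun t => f t * (starRingEnd ℂ) (g t) :=
  (L2.integrable_inner g f).congr (Filter.Eventually.of_forall fun _ => rfl)

theorem continuous_modulation (f : L2 d) :
    Continuous fun w : EuclideanSpace ℝ (Fin d) => modulation w f := by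
  rw [continuous_iff_continuousAt]
  intro w₀
  have hinner : Continuous fun w => (inner ℂ (modulation w₀ f) (modulation w f) : ℂ) := by
    have h1 : ∀ w, (inner ℂ (modulation w₀ f) (modulation w f) : ℂ)
        = ∫ t, (f t * phase (inner ℝ w t)) * (starRingEnd ℂ) (modulation w₀ f t) := by
      intro w
      rw [L2.inner_def]
      refine integral_congr_ae ?_
      filter_upwards [modulation_coeFn w f] with t ht
      rw [RCLike.inner_apply, ht]
    simp only [h1]
    refine continuous_of_dominated (bound := fun t => ‖f t * (starRingEnd ℂ) (modulation w₀ f t)‖)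
      (fun w => ?_) (fun w => Filter.Eventually.of_forall fun t => ?_)
      (integrable_mul_conj f _).norm (Filter.Eventually.of_forall fun t => ?_)
    · exact ((Lp.aestronglyMeasurable f).mul (continuous_phase.comp
        (continuous_const.inner continuous_id)).aestronglyMeasurable).mul
        (Complex.continuous_conj.comp_aestronglyMeasurable (Lp.aestronglyMeasurable _))
    · rw [norm_mul, norm_mul, norm_mul, norm_phase, mul_one]
    · exact (continuous_const.mul (continuous_phase.comp
        (continuous_id.inner continuous_const))).mul continuous_const
  rw [ContinuousAt, tendsto_iff_norm_sub_tendsto_zero]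
  -- For isometries the distance is determined by one inner product, so weak continuity suffices.
  have h2 : ∀ w, ‖modulation w f - modulation w₀ f‖
      = √(2 * ‖f‖ ^ 2 - 2 * (inner ℂ (modulation w₀ f) (modulation w f) : ℂ).re) := by
    intro w
    rw [← Real.sqrt_sq (norm_nonneg (modulation w f - modulation w₀ f)),
      @norm_sub_sq ℂ, norm_modulation, norm_modulation, ← inner_re_symm]
    congr 1
    simp only [RCLike.re_eq_complex_re]
    ring
  simp only [h2]
  have h3 : Continuous fun w => √(2 * ‖f‖ ^ 2 -
      2 * (inner ℂ (modulation w₀ f) (modulation w f) : ℂ).re) := by fun_prop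
  convert h3.tendsto w₀ using 2
  rw [← h2, sub_self, norm_zero]

theorem continuous_translation_modulation (f : L2 d) :
    Continuous fun z : EuclideanSpace ℝ (Fin d) × EuclideanSpace ℝ (Fin d) =>
      translation z.1 (modulation z.2 f) := by
  refine Continuous.compMeasurePreservingLp ((continuous_modulation f).comp continuous_snd)
    (g := fun z => (⟨fun t => t - z.1, by fun_prop⟩ : C(EuclideanSpace ℝ (Fin d),
      EuclideanSpace ℝ (Fin d)))) ?_ (fun z => measurePreserving_sub_right volume z.1)
    ENNReal.ofNat_ne_top
  exact ContinuousMap.continuous_of_continuous_uncurry _ (by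
    change Continuous fun q : (EuclideanSpace ℝ (Fin d) × EuclideanSpace ℝ (Fin d)) ×
      EuclideanSpace ℝ (Fin d) => q.2 - q.1.1
    fun_prop)

theorem continuous_timePart : Continuous (timePart : Phase d → EuclideanSpace ℝ (Fin d)) :=
  (PiLp.continuous_toLp 2 _).comp (continuous_pi fun _ => continuous_apply _)

theorem continuous_freqPart : Continuous (freqPart : Phase d → EuclideanSpace ℝ (Fin d)) :=
  (PiLp.continuous_toLp 2 _).comp (continuous_pi fun _ => continuous_apply _)

theorem continuous_tfShift (f : L2 d) : Continuous fun p : Phase d => tfShift p f := by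
  have h : Continuous fun p : Phase d => (timePart p, freqPart p) :=
    continuous_timePart.prodMk continuous_freqPart
  have h2 := (continuous_translation_modulation f).comp h
  unfold tfShift
  exact h2

end Shifts

/-! ### Moyal's identity and its polarization -/

section Orthogonality

open FourierTransform ComplexConjugate

variable {d : ℕ}

theorem lintegral_enorm_sq_coeFn (f : L2 d) : ∫⁻ t, ‖f t‖ₑ ^ 2 = ENNReal.ofReal (‖f‖ ^ 2) := by
  have h : eLpNorm f 2 volume = ENNReal.ofReal ‖f‖ := by
    rw [← Lp.enorm_def, ofReal_norm]
  have h2 := congrArg (· ^ (2 : ℝ)) h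
  simp only [eLpNorm_eq_lintegral_rpow_enorm_toReal two_ne_zero ENNReal.ofNat_ne_top,
    ENNReal.toReal_ofNat, ← ENNReal.rpow_mul] at h2
  rw [ENNReal.ofReal_pow (norm_nonneg f)]
  simpa using h2

/-- The short-time Fourier transform of `f` as a Fourier integral. -/
theorem enorm_inner_translation_modulation (x w : EuclideanSpace ℝ (Fin d)) (g f : L2 d) :
    ‖(inner ℂ (translation x (modulation w g)) f : ℂ)‖ₑ
      = ‖𝓕 (fun t => f t * conj (g (t - x))) w‖ₑ := by
  have h : (inner ℂ (translation x (modulation w g)) f : ℂ)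
      = phase (inner ℝ w x) * 𝓕 (fun t => f t * conj (g (t - x))) w := by
    rw [L2.inner_def, Real.fourier_eq, ← integral_const_mul]
    refine integral_congr_ae ?_
    filter_upwards [(translation_coeFn x (modulation w g)).trans
      ((measurePreserving_sub_right volume x).quasiMeasurePreserving.ae_eq_comp
        (modulation_coeFn w g))] with t ht
    rw [RCLike.inner_apply, ht]
    simp only [Function.comp_apply, map_mul, conj_phase]
    have h1 : (Real.fourierChar (-inner ℝ t w) • (f t * conj (g (t - x))) : ℂ)
        = phase (-inner ℝ t w) * (f t * conj (g (t - x))) := by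
      rw [Circle.smul_def, Real.fourierChar_apply, smul_eq_mul, phase]
      congr 2
      push_cast; ring
    rw [h1, ← mul_assoc (phase (inner ℝ w x)), ← phase_add]
    have h2 : inner ℝ w x + -inner ℝ t w = -inner ℝ w (t - x) := by
      rw [inner_sub_right, real_inner_comm t w]; ring
    rw [h2]; ring
  rw [h, enorm_mul, ← ofReal_norm (phase _), norm_phase, ENNReal.ofReal_one, one_mul]

theorem lintegral_lintegral_enorm_sq (g f : L2 d) :
    ∫⁻ x, ∫⁻ t, ‖f t * conj (g (t - x))‖ₑ ^ 2
      = ENNReal.ofReal (‖g‖ ^ 2) * ENNReal.ofReal (‖f‖ ^ 2) := by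
  have hf : Measurable fun t => ‖f t‖ₑ ^ 2 := (Lp.stronglyMeasurable f).measurable.enorm.pow_const 2
  have hg : Measurable fun t => ‖g t‖ₑ ^ 2 := (Lp.stronglyMeasurable g).measurable.enorm.pow_const 2
  have e1 : ∀ x t, ‖f t * conj (g (t - x))‖ₑ ^ 2 = ‖f t‖ₑ ^ 2 * ‖g (t - x)‖ₑ ^ 2 := fun x t => by
    rw [enorm_mul, RCLike.enorm_conj, mul_pow]
  simp only [e1]
  rw [lintegral_lintegral_swap]
  · have e2 : ∀ t, ∫⁻ x, ‖f t‖ₑ ^ 2 * ‖g (t - x)‖ₑ ^ 2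
        = ‖f t‖ₑ ^ 2 * ENNReal.ofReal (‖g‖ ^ 2) := fun t => by
      rw [lintegral_const_mul _ (by exact hg.comp (measurable_const.sub measurable_id)),
        lintegral_sub_left_eq_self (fun x => ‖g x‖ₑ ^ 2), lintegral_enorm_sq_coeFn]
    simp only [e2]
    rw [lintegral_mul_const _ hf, lintegral_enorm_sq_coeFn, mul_comm]
  · exact ((hf.comp measurable_snd).mul (hg.comp (measurable_snd.sub measurable_fst))).aemeasurable

theorem measurePreserving_timePart_freqPart :
    MeasurePreserving (fun p : Phase d => (timePart p, freqPart p)) := by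
  have h1 := volume_measurePreserving_sumPiEquivProdPi fun _ : Fin d ⊕ Fin d => ℝ
  have h2 := (EuclideanSpace.volume_preserving_symm_measurableEquiv_toLp (Fin d)).symm
  exact (h2.prod h2).comp h1

/-- Moyal's identity, in `ℝ≥0∞`. -/
theorem lintegral_enorm_sq_inner_tfShift (g f : L2 d) :
    ∫⁻ p : Phase d, ‖(inner ℂ (tfShift p g) f : ℂ)‖ₑ ^ 2
      = ENNReal.ofReal (‖g‖ ^ 2) * ENNReal.ofReal (‖f‖ ^ 2) := by
  have hcont : Continuous fun z : EuclideanSpace ℝ (Fin d) × EuclideanSpace ℝ (Fin d) =>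
      (inner ℂ (translation z.1 (modulation z.2 g)) f : ℂ) :=
    (continuous_translation_modulation g).inner continuous_const
  have hmeas : Measurable fun z : EuclideanSpace ℝ (Fin d) × EuclideanSpace ℝ (Fin d) =>
      ‖(inner ℂ (translation z.1 (modulation z.2 g)) f : ℂ)‖ₑ ^ 2 :=
    hcont.measurable.enorm.pow_const 2
  have h1 := measurePreserving_timePart_freqPart.lintegral_comp hmeas
  have h2 : ∫⁻ p : Phase d, ‖(inner ℂ (tfShift p g) f : ℂ)‖ₑ ^ 2
      = ∫⁻ p : Phase d, ‖(inner ℂ (translation (timePart p) (modulation (freqPart p) g)) f : ℂ)‖ₑ ^ 2 := by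
    unfold tfShift; rfl
  rw [h2, h1, Measure.volume_eq_prod, lintegral_prod _ hmeas.aemeasurable,
    ← lintegral_lintegral_enorm_sq]
  have hf := Lp.stronglyMeasurable f
  have hg := Lp.stronglyMeasurable g
  have hfg : Measurable fun z : EuclideanSpace ℝ (Fin d) × EuclideanSpace ℝ (Fin d) =>
      ‖f z.2 * conj (g (z.2 - z.1))‖ₑ ^ 2 :=
    ((hf.measurable.comp measurable_snd).mul (Complex.continuous_conj.measurable.comp
      (hg.measurable.comp (measurable_snd.sub measurable_fst)))).enorm.pow_const 2
  -- Plancherel in the frequency variable needs the product in L¹ ∩ L²; the L² part holds only for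
  -- almost every x.
  have hfin : ∀ᵐ x : EuclideanSpace ℝ (Fin d), ∫⁻ t, ‖f t * conj (g (t - x))‖ₑ ^ 2 < ⊤ :=
    ae_lt_top hfg.lintegral_prod_right (by
      rw [lintegral_lintegral_enorm_sq]
      exact ENNReal.mul_ne_top ENNReal.ofReal_ne_top ENNReal.ofReal_ne_top)
  refine lintegral_congr_ae ?_
  filter_upwards [hfin] with x hx
  simp only [enorm_inner_translation_modulation]
  have hsm : AEStronglyMeasurable (fun t => f t * conj (g (t - x))) volume :=
    hf.aestronglyMeasurable.mul (Complex.continuous_conj.comp_aestronglyMeasurable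
      (hg.comp_measurable (measurable_id.sub_const x)).aestronglyMeasurable)
  refine lintegral_enorm_sq_fourier ?_ ⟨hsm, ?_⟩
  · refine (integrable_mul_conj f (translation x g)).congr ?_
    filter_upwards [translation_coeFn x g] with t ht
    rw [ht]
  · rw [eLpNorm_lt_top_iff_lintegral_rpow_enorm_lt_top two_ne_zero ENNReal.ofNat_ne_top]
    simpa using hx

theorem memLp_inner_tfShift (g f : L2 d) :
    MemLp (fun p : Phase d => (inner ℂ (tfShift p g) f : ℂ)) 2 := by
  refine ⟨((continuous_tfShift g).inner continuous_const).aestronglyMeasurable, ?_⟩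
  rw [eLpNorm_lt_top_iff_lintegral_rpow_enorm_lt_top two_ne_zero ENNReal.ofNat_ne_top]
  have h := lintegral_enorm_sq_inner_tfShift g f
  simp only [ENNReal.toReal_ofNat, ENNReal.rpow_ofNat]
  rw [h]
  exact ENNReal.mul_lt_top ENNReal.ofReal_lt_top ENNReal.ofReal_lt_top

theorem integrable_inner_tfShift_mul (g k h f : L2 d) :
    Integrable fun p : Phase d => (inner ℂ (tfShift p g) k * inner ℂ h (tfShift p f) : ℂ) := by
  have h1 : MemLp (fun p : Phase d => (inner ℂ h (tfShift p f) : ℂ)) 2 := by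
    refine (memLp_inner_tfShift f h).star.ae_eq (Filter.Eventually.of_forall fun p => ?_)
    exact inner_conj_symm _ _
  exact (memLp_inner_tfShift g k).integrable_mul h1

theorem integral_inner_tfShift_mul_self (g k : L2 d) :
    ∫ p : Phase d, (inner ℂ (tfShift p g) k * inner ℂ k (tfShift p g) : ℂ)
      = inner ℂ k k * inner ℂ g g := by
  have h1 : ∀ p : Phase d, (inner ℂ (tfShift p g) k * inner ℂ k (tfShift p g) : ℂ)
      = ((‖(inner ℂ (tfShift p g) k : ℂ)‖ ^ 2 : ℝ) : ℂ) := fun p => by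
    rw [← inner_conj_symm k, Complex.mul_conj, Complex.normSq_eq_norm_sq]
  have hm : AEStronglyMeasurable (fun p : Phase d => ‖(inner ℂ (tfShift p g) k : ℂ)‖ ^ 2) volume :=
    (((continuous_tfShift g).inner continuous_const).norm.pow 2).aestronglyMeasurable
  simp only [h1]
  rw [integral_complex_ofReal, integral_eq_lintegral_of_nonneg_ae
    (Filter.Eventually.of_forall fun _ => by positivity) hm]
  have h2 : ∀ p : Phase d, ENNReal.ofReal (‖(inner ℂ (tfShift p g) k : ℂ)‖ ^ 2)
      = ‖(inner ℂ (tfShift p g) k : ℂ)‖ₑ ^ 2 := fun p => by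
    rw [ENNReal.ofReal_pow (norm_nonneg _), ofReal_norm]
  simp only [h2]
  rw [lintegral_enorm_sq_inner_tfShift, ENNReal.toReal_mul, ENNReal.toReal_ofReal (by positivity),
    ENNReal.toReal_ofReal (by positivity), inner_self_eq_norm_sq_to_K, inner_self_eq_norm_sq_to_K]
  push_cast
  simp [mul_comm]

/-- A sesquilinear form that vanishes on the diagonal is zero. -/
theorem sesquilinear_eq_zero {H : Type*} [AddCommGroup H] [Module ℂ H] {B : H → H → ℂ}
    (addl : ∀ x y z, B (x + y) z = B x z + B y z) (addr : ∀ x y z, B x (y + z) = B x y + B x z)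
    (smull : ∀ x y, B (Complex.I • x) y = -Complex.I * B x y)
    (smulr : ∀ x y, B x (Complex.I • y) = Complex.I * B x y) (h : ∀ x, B x x = 0) (x y : H) :
    B x y = 0 := by
  have h1 : ∀ x y, B x y + B y x = 0 := fun x y => by
    have := h (x + y)
    rw [addl, addr, addr, h, h] at this
    linear_combination this
  have h2 := h1 x (Complex.I • y)
  rw [smull, smulr] at h2
  have h3 : B x y - B y x = 0 := by
    have : Complex.I * (B x y - B y x) = 0 := by linear_combination h2
    exact (mul_eq_zero.mp this).resolve_left Complex.I_ne_zero
  linear_combination (h1 x y + h3) / 2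

/-- The orthogonality relations for the short-time Fourier transform. -/
theorem integral_inner_tfShift_mul (g k h f : L2 d) :
    ∫ p : Phase d, (inner ℂ (tfShift p g) k * inner ℂ h (tfShift p f) : ℂ)
      = inner ℂ h k * inner ℂ g f := by
  have hadd : ∀ p (x y : L2 d), tfShift (d := d) p (x + y) = tfShift p x + tfShift p y := fun p =>
    (tfShiftIsometry p).map_add
  -- Polarize first in (h, k) with equal windows, then in (g, f).
  have step : ∀ g h k : L2 d, (∫ p : Phase d, (inner ℂ (tfShift p g) k * inner ℂ h (tfShift p g) : ℂ))
      - inner ℂ h k * inner ℂ g g = 0 := by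
    intro g
    refine sesquilinear_eq_zero (B := fun h k => (∫ p : Phase d,
      (inner ℂ (tfShift p g) k * inner ℂ h (tfShift p g) : ℂ)) - inner ℂ h k * inner ℂ g g)
      (fun x y z => ?_) (fun x y z => ?_) (fun x y => ?_) (fun x y => ?_) fun x => ?_
    · simp only [inner_add_left, mul_add]
      rw [integral_add (integrable_inner_tfShift_mul _ _ _ _) (integrable_inner_tfShift_mul _ _ _ _)]
      ring
    · simp only [inner_add_right, add_mul]
      rw [integral_add (integrable_inner_tfShift_mul _ _ _ _) (integrable_inner_tfShift_mul _ _ _ _)]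
      ring
    · simp only [inner_smul_left, Complex.conj_I, mul_left_comm _ (-Complex.I)]
      rw [integral_const_mul]
      ring
    · simp only [inner_smul_right, mul_assoc]
      rw [integral_const_mul]
      ring
    · rw [integral_inner_tfShift_mul_self, sub_self]
  rw [← sub_eq_zero]
  refine sesquilinear_eq_zero (B := fun g f => (∫ p : Phase d,
      (inner ℂ (tfShift p g) k * inner ℂ h (tfShift p f) : ℂ)) - inner ℂ h k * inner ℂ g f)
      (fun x y z => ?_) (fun x y z => ?_) (fun x y => ?_) (fun x y => ?_) (fun x => step x h k) g f
  · simp only [hadd, inner_add_left, add_mul]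
    rw [integral_add (integrable_inner_tfShift_mul _ _ _ _) (integrable_inner_tfShift_mul _ _ _ _)]
    ring
  · simp only [hadd, inner_add_right, mul_add]
    rw [integral_add (integrable_inner_tfShift_mul _ _ _ _) (integrable_inner_tfShift_mul _ _ _ _)]
    ring
  · simp only [tfShift_smul, inner_smul_left, Complex.conj_I, mul_assoc]
    rw [integral_const_mul]
    ring
  · simp only [tfShift_smul, inner_smul_right, mul_left_comm _ Complex.I]
    rw [integral_const_mul]
    ring

end Orthogonality

/-! ### Symplectic lattices give dual pairs -/

section Lattice

variable {d : ℕ}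

theorem symplectic_abs_det {A : Matrix (Fin d ⊕ Fin d) (Fin d ⊕ Fin d) ℝ}
    (hA : A ∈ Matrix.symplecticGroup (Fin d) ℝ) : |A.det| = 1 := by
  rw [SymplecticGroup.det_eq_one hA, abs_one]

theorem det_ne_zero_of_one_lt_density {L : Matrix (Fin d ⊕ Fin d) (Fin d ⊕ Fin d) ℝ}
    (hξ : 1 < density L) : L.det ≠ 0 := by
  intro h
  simp only [density, h, abs_zero, div_zero] at hξ
  linarith

/-- For `L = c A` with `A` symplectic, the factor `ξ ^ (1 / d)` is `c⁻²`. -/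
theorem density_rpow {A : Matrix (Fin d ⊕ Fin d) (Fin d ⊕ Fin d) ℝ} {c : ℝ} (hc : c ≠ 0)
    (hA : A ∈ Matrix.symplecticGroup (Fin d) ℝ) (hξ : 1 < density (c • A)) :
    density (c • A) ^ ((1 : ℝ) / d) * c ^ 2 = 1 := by
  have hdet : density (c • A) = (c ^ 2)⁻¹ ^ d := by
    rw [density, Matrix.det_smul, abs_mul, symplectic_abs_det hA, mul_one, Fintype.card_sum,
      Fintype.card_fin, ← two_mul, abs_pow, pow_mul, sq_abs, one_div, inv_pow]
  -- In dimension 0 the density would be 1, contrary to `hξ`.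
  have hd : d ≠ 0 := by
    rintro rfl
    rw [hdet, pow_zero] at hξ
    exact lt_irrefl _ hξ
  rw [hdet, one_div, Real.pow_rpow_inv_natCast (by positivity) hd]
  field_simp

/-- The coordinates of a lattice with respect to its generator matrix. -/
noncomputable def latticeEquiv (M : Matrix (Fin d ⊕ Fin d) (Fin d ⊕ Fin d) ℝ) (hM : M.det ≠ 0) :
    (Fin d ⊕ Fin d → ℤ) ≃ lattice M :=
  Equiv.ofBijective (fun k => ⟨M.mulVec (intPoint k), k, rfl⟩) ⟨fun k l h => by
    have h1 : M.mulVec (intPoint k) = M.mulVec (intPoint l) := congrArg Subtype.val h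
    have h2 := Matrix.mulVec_injective_of_isUnit ((Matrix.isUnit_iff_isUnit_det M).mpr hM.isUnit) h1
    ext i
    have h3 : (k i : ℝ) = l i := congrFun h2 i
    exact_mod_cast h3, fun ⟨p, k, hk⟩ => ⟨k, Subtype.ext hk.symm⟩⟩

/-- The action of the symplectic form on integer coordinates. -/
def symplecticSwap (d : ℕ) : (Fin d ⊕ Fin d → ℤ) ≃ (Fin d ⊕ Fin d → ℤ) where
  toFun k := Sum.elim (fun i => k (Sum.inr i)) fun i => -k (Sum.inl i)
  invFun n := Sum.elim (fun i => -n (Sum.inr i)) fun i => n (Sum.inl i)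
  left_inv k := by ext (i | i) <;> simp
  right_inv n := by ext (i | i) <;> simp

theorem J_mulVec (q : Phase d) : (Matrix.J (Fin d) ℝ).mulVec q =
    Sum.elim (fun i => -q (Sum.inr i)) fun i => q (Sum.inl i) := by
  rw [Matrix.J, Matrix.fromBlocks_mulVec, Matrix.zero_mulVec, Matrix.zero_mulVec, Matrix.neg_mulVec,
    Matrix.one_mulVec, Matrix.one_mulVec, zero_add, add_zero]
  rfl

theorem symplectic_form_eq (p q : Phase d) :
    (inner ℝ (freqPart p) (timePart q) - inner ℝ (freqPart q) (timePart p) : ℝ)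
      = p ⬝ᵥ (Matrix.J (Fin d) ℝ).mulVec q := by
  rw [J_mulVec]
  simp [PiLp.inner_apply, freqPart, timePart, dotProduct, mul_comm, sub_eq_add_neg, add_comm]

/-- A preserves the form and the scalars contribute a c² = 1. This is what makes the rescaled
lattice adjoint to the original one. -/
theorem symplectic_form_generator {A : Matrix (Fin d ⊕ Fin d) (Fin d ⊕ Fin d) ℝ} {a c : ℝ}
    (hA : A ∈ Matrix.symplecticGroup (Fin d) ℝ) (ha : a * c ^ 2 = 1) (s t : Phase d) :
    (a • (c • A)).mulVec s ⬝ᵥ (Matrix.J (Fin d) ℝ).mulVec ((c • A).mulVec t)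
      = s ⬝ᵥ (Matrix.J (Fin d) ℝ).mulVec t := by
  have h : A.mulVec s ⬝ᵥ (Matrix.J (Fin d) ℝ).mulVec (A.mulVec t)
      = s ⬝ᵥ (Matrix.J (Fin d) ℝ).mulVec t := by
    conv_rhs => rw [← SymplecticGroup.mem_iff'.mp hA, ← Matrix.mulVec_mulVec, ← Matrix.mulVec_mulVec,
      Matrix.dotProduct_mulVec, Matrix.vecMul_transpose]
  simp only [Matrix.smul_mulVec, Matrix.mulVec_smul, smul_dotProduct, dotProduct_smul, smul_eq_mul]
  rw [h]
  linear_combination (s ⬝ᵥ (Matrix.J (Fin d) ℝ).mulVec t) * ha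

theorem intPoint_symplecticSwap (k : Fin d ⊕ Fin d → ℤ) (s : Phase d) :
    intPoint (symplecticSwap d k) ⬝ᵥ s = intPoint k ⬝ᵥ (Matrix.J (Fin d) ℝ).mulVec s := by
  rw [J_mulVec]
  simp [dotProduct, symplecticSwap, intPoint, add_comm]

theorem mFourier_torusMk {I : Type*} [Fintype I] (n : I → ℤ) (s : I → ℝ) :
    UnitAddTorus.mFourier n (torusMk s) = phase (intPoint n ⬝ᵥ s) := by
  simp only [UnitAddTorus.mFourier, ContinuousMap.coe_mk, torusMk, fourier_coe_apply, phase,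
    ← Complex.exp_sum, dotProduct, intPoint]
  congr 1
  push_cast
  rw [Finset.mul_sum]
  refine Finset.sum_congr rfl fun i _ => ?_
  ring

theorem isDualPair_tfShift {L : Matrix (Fin d ⊕ Fin d) (Fin d ⊕ Fin d) ℝ}
    (hL : IsSymplecticGenerator L) (hξ : 1 < density L) :
    ∃ χ : adjointLattice L ≃ (Fin d ⊕ Fin d → ℤ),
    IsDualPair (density L) (fun s => tfShiftEquiv (L.mulVec s))
      (fun ν : adjointLattice L => tfShiftEquiv (ν : Phase d)) χ := by
  obtain ⟨c, hc, A, hA, rfl⟩ := hL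
  have hdet := det_ne_zero_of_one_lt_density hξ
  have ha := density_rpow hc hA hξ
  set a := density (c • A) ^ ((1 : ℝ) / d) with hadef
  have ha0 : a ≠ 0 := left_ne_zero_of_mul (ha.trans_ne one_ne_zero)
  have hdet' : (a • (c • A)).det ≠ 0 := by
    rw [Matrix.det_smul]
    exact mul_ne_zero (pow_ne_zero _ ha0) hdet
  have hmap := Real.map_matrix_volume_pi_eq_smul_volume_pi hdet
  have hemb : MeasurableEmbedding (Matrix.toLin' (c • A)) :=
    (LinearMap.toContinuousLinearMap (Matrix.toLin' (c • A))).continuous.measurableEmbedding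
      (Matrix.mulVec_injective_of_isUnit ((Matrix.isUnit_iff_isUnit_det _).mpr hdet.isUnit))
  have hdens : ENNReal.ofReal |(c • A).det⁻¹| = ENNReal.ofReal (density (c • A)) := by
    rw [density, abs_inv, one_div]
  have hpos : 0 < density (c • A) := zero_lt_one.trans hξ
  let e : (Fin d ⊕ Fin d → ℤ) ≃ adjointLattice (c • A) := latticeEquiv _ hdet'
  -- χ sends the adjoint point with coordinates k to the integer vector n with n·s = k·Js, so the
  -- commutation phase becomes the character of n.
  refine ⟨e.symm.trans (symplecticSwap d), ⟨hpos, ?_, ?_, ?_, ?_, ?_, ?_, ?_, ?_⟩⟩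
  · intro h
    exact (continuous_tfShift h).comp (LinearMap.toContinuousLinearMap (Matrix.toLin' (c • A))).continuous
  · intro h
    rw [tfShiftEquiv_apply, Matrix.mulVec_zero, tfShift_zero]
  · intro s t
    refine ⟨phase (-inner ℝ (freqPart ((c • A).mulVec s)) (timePart ((c • A).mulVec t))),
      norm_phase _, fun h => ?_⟩
    rw [tfShiftEquiv_apply, Matrix.mulVec_add]
    exact tfShift_add _ _ h
  · intro h
    exact tfShift_zero h
  · intro ν μ
    exact ⟨_, norm_phase _, fun h => tfShift_add _ _ h⟩
  · intro ν s h
    obtain ⟨k, rfl⟩ := e.surjective ν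
    have he : (e k : Phase d) = (a • (c • A)).mulVec (intPoint k) := rfl
    rw [Equiv.trans_apply, Equiv.symm_apply_apply, mFourier_torusMk, intPoint_symplecticSwap, he,
      ← symplectic_form_generator hA ha, ← symplectic_form_eq]
    exact tfShift_comm _ _ h
  · intro g k h f
    have h1 := integrable_inner_tfShift_mul g k h f
    have h2 : Integrable (fun p : Phase d => (inner ℂ (tfShift p g) k * inner ℂ h (tfShift p f) : ℂ))
        (Measure.map (Matrix.toLin' (c • A)) volume) := by
      rw [hmap]
      exact h1.smul_measure ENNReal.ofReal_ne_top
    exact hemb.integrable_map_iff.mp h2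
  · intro g k h f
    -- The substitution p = Ls has Jacobian |det L|, which is where the constant ξ comes from.
    have h1 := hemb.integral_map (μ := volume)
      (fun p : Phase d => (inner ℂ (tfShift p g) k * inner ℂ h (tfShift p f) : ℂ))
    rw [hmap, hdens, integral_smul_measure, integral_inner_tfShift_mul,
      ENNReal.toReal_ofReal hpos.le] at h1
    exact h1.symm

end Lattice

end Gabor

/-! ### Transfer from integer coordinates to lattice points -/

theorem lemma6 (d : ℕ) (L : Matrix (Fin d ⊕ Fin d) (Fin d ⊕ Fin d) ℝ)
    (hL : Gabor.IsSymplecticGenerator L) (hξ : 1 < Gabor.density L) (f : Gabor.L2 d)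
    (hf : Gabor.IsRieszBasis (Gabor.gaborSystem f (Gabor.adjointLattice L))
      (Gabor.closedSpan (Gabor.gaborSystem f (Gabor.adjointLattice L)))) :
    ∃ (R : Gabor.ell2 (Gabor.adjointLattice L) →L[ℂ] Gabor.ell2 (Gabor.adjointLattice L))
      (S : Gabor.L2 d →L[ℂ] Gabor.L2 d) (φ : Gabor.L2 d),
      (Gabor.IsGramOperator (Gabor.gaborSystem f (Gabor.adjointLattice L)) R ∧
        R.IsPositive ∧ IsUnit R) ∧
      (Gabor.IsFrameOperator (Gabor.gaborSystem f (Gabor.lattice L)) S ∧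
        S.IsPositive ∧ IsUnit S) ∧
      HasSum (fun p : Gabor.adjointLattice L =>
        Gabor.entry (Gabor.invSqrt R) p 0 • Gabor.gaborSystem f (Gabor.adjointLattice L) p) φ ∧
      φ = (Real.sqrt (Gabor.density L) : ℂ) • Gabor.invSqrt S f ∧
      Orthonormal ℂ (Gabor.gaborSystem φ (Gabor.adjointLattice L)) := by
  obtain ⟨χ, hp⟩ := Gabor.isDualPair_tfShift hL hξ
  obtain ⟨-, A, B, hA, hB, hriesz⟩ := hf
  obtain ⟨R, S, φ, hR, ⟨hS, hS'⟩, hφ⟩ :=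
    hp.exists_gram_frame_orthonormal (f := f) hA hB (Gabor.riesz_finset hriesz)
  refine ⟨R, S, φ, hR, ⟨fun h => ?_, hS'⟩, hφ⟩
  rw [← (Gabor.latticeEquiv L (Gabor.det_ne_zero_of_one_lt_density hξ)).hasSum_iff]
  exact hS h
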